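/- Let $\mathcal H$ be a complex Hilbert space, $\hbar,\kappa>0$, let $H$ be a self-adjoint operator in $\mathcal H$ and $U(t)=e^{-\mathrm iHt/\hbar}$. Let $\mathbf R=(R^1,\dots,R^d)$ be (strongly) commuting self-adjoint operators in $\mathcal H$ with joint spectral measure $E$, so that $f(\mathbf R)=\int f(\mathbf x)\,E(\mathrm d\mathbf x)$. Let the pointer scale be either $\Lambda=\mathbb R^d$ with Lebesgue measure $\lambda$, or $\Lambda=\varepsilon\mathbb Z^d$ $(\varepsilon>0)$ with mass $\varepsilon^d$ at every point; in the latter case the joint spectral measure of $\kappa\mathbf R$ is assumed to be concentrated on $\Lambda$. Let $f_0\in L^2(\Lambda)$ with $\|f_0\|=1$, and let $\mathrm d\mu_0=|f_0|^2\mathrm d\lambda$. Put $1_t=1$ for $t>0$, $1_t=0$ for $t\le 0$, and define for $\mu_0$-almost every $\mathbf y\in\Lambda$ the (possibly unbounded) operators $$G_t(\mathbf y)=\frac{f_0(\mathbf yI-\kappa 1_t\mathbf R)}{f_0(\mathbf y)},\qquad G(\mathbf y)=\frac{f_0(\mathbf yI-\kappa\mathbf R)}{f_0(\mathbf y)},\qquad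 G_t(r,\mathbf y)=U(r)^\dagger G_t(\mathbf y)U(r).$$ Let $t_0\le 0$, $\eta\in\mathcal H$ and $\chi(t,\mathbf y)=U(t-t_0)\,G_t(-t_0,\mathbf y)\,\eta$. Then $\mu_0$ is a probability measure; for $\mu_0$-almost every $\mathbf y$ the vector $U(-t_0)\eta$ is in the domain of $G_t(\mathbf y)$ for all $t$; and $\chi(t)$, $t\ge t_0$, is a stochastic vector process in $L^2(\mu_0;\mathcal H)$ which satisfies the single-kick equation $$\mathrm d\chi(t)+\frac{\mathrm i}{\hbar}H\chi(t)\,\mathrm dt=\mathrm d1_t\,[G-I]\,\chi(t),\qquad \chi(t_0)=\eta,$$ in the sense of Itô (forward differentials). This means the following. For every $r\in[t_0,0]$, $\chi(r,\mathbf y)$ is in the domain of $G(\mathbf y)$ for $\mu_0$-almost every $\mathbf y$. For every $t\ge t_0$ the kick term $J(t,\mathbf y)=\int_{[t_0,t)}\mathrm d1_r\,[G(\mathbf y)-I]\chi(r,\mathbf y)$ is the limit in $L^2(\mu_0;\mathcal H)$ of the sums $\sum_i(1_{p_{i+1}}-1_{p_i})[G-I]\chi(p_i)$ over partitions $t_0=p_0\le\dots\le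 p_n=t$ with mesh tending to $0$. And for $\mu_0$-almost every $\mathbf y$ one has $\chi(t_0,\mathbf y)=\eta$ and, for all $t\ge t_0$: 1. $\int_{t_0}^t\chi(s,\mathbf y)\,\mathrm ds$ exists, is in the domain of $H$, and $\chi(t,\mathbf y)-\eta+\frac{\mathrm i}{\hbar}H\int_{t_0}^t\chi(s,\mathbf y)\,\mathrm ds=J(t,\mathbf y)$; 2. if $\chi(s,\mathbf y)$ is in the domain of $H$ for all $s\in[t_0,t]$, then $H\chi(\cdot,\mathbf y)$ is integrable on $[t_0,t]$ and $\chi(t,\mathbf y)-\eta+\frac{\mathrm i}{\hbar}\int_{t_0}^tH\chi(s,\mathbf y)\,\mathrm ds=J(t,\mathbf y)$; 3. $\chi(t,\mathbf y)=e^{-\mathrm iHt/\hbar}\Bigl(e^{\mathrm iHt_0/\hbar}\eta+\int_{[t_0,t)}e^{\mathrm iHr/\hbar}\,\mathrm d1_r\,[G(\mathbf y)-I]\chi(r,\mathbf y)\Bigr)$. -/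

import Mathlib

open MeasureTheory Filter Topology Set

noncomputable section

/-- Coordinate space `ℝᵈ`. -/
abbrev Coord (d : ℕ) : Type := EuclideanSpace ℝ (Fin d)

/-! ### Spectral measures and functional calculus -/

/-- A projection-valued measure on a measurable space `X`, acting in a Hilbert space `𝓗`.
Values on non-measurable sets are irrelevant. -/
structure SpectralMeasure (X : Type*) [MeasurableSpace X] (𝓗 : Type*)
    [NormedAddCommGroup 𝓗] [InnerProductSpace ℂ 𝓗] [CompleteSpace 𝓗] where
  /-- the projection attached to a set -/
  proj : Set X → 𝓗 →L[ℂ] 𝓗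
  isStarProjection : ∀ A, MeasurableSet A → IsStarProjection (proj A)
  proj_empty : proj ∅ = 0
  proj_univ : proj univ = 1
  proj_inter : ∀ A B, MeasurableSet A → MeasurableSet B → proj (A ∩ B) = proj A * proj B
  hasSum_iUnion : ∀ A : ℕ → Set X, (∀ n, MeasurableSet (A n)) →
    Pairwise (fun m n => Disjoint (A m) (A n)) → ∀ ψ : 𝓗,
      HasSum (fun n => proj (A n) ψ) (proj (⋃ n, A n) ψ)

namespace SpectralMeasure

variable {X : Type*} [MeasurableSpace X] {𝓗 : Type*}
  [NormedAddCommGroup 𝓗] [InnerProductSpace ℂ 𝓗] [CompleteSpace 𝓗]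

theorem norm_sq_eq (E : SpectralMeasure X 𝓗) {A : Set X} (hA : MeasurableSet A) (ψ : 𝓗) :
    ‖E.proj A ψ‖ ^ 2 = RCLike.re (inner ℂ ψ (E.proj A ψ)) := by
  have h := E.isStarProjection A hA
  have hadj : ContinuousLinearMap.adjoint (E.proj A) = E.proj A := h.isSelfAdjoint
  have hid : E.proj A (E.proj A ψ) = E.proj A ψ :=
    DFunLike.congr_fun h.isIdempotentElem ψ
  rw [← inner_self_eq_norm_sq (𝕜 := ℂ), ← ContinuousLinearMap.adjoint_inner_right, hadj, hid]

/-- The scalar measure `A ↦ ‖E(A)ψ‖² = ⟨ψ, E(A)ψ⟩`. -/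
def measure (E : SpectralMeasure X 𝓗) (ψ : 𝓗) : Measure X :=
  Measure.ofMeasurable (fun A _ => ENNReal.ofReal (‖E.proj A ψ‖ ^ 2))
    (by simp [E.proj_empty])
    (by
      intro A hA hd
      have hs := (E.hasSum_iUnion A hA hd ψ).mapL
        ((RCLike.reCLM (K := ℂ)).comp ((innerSL ℂ ψ).restrictScalars ℝ))
      have hs' : HasSum (fun n => ‖E.proj (A n) ψ‖ ^ 2) (‖E.proj (⋃ n, A n) ψ‖ ^ 2) := by
        rw [E.norm_sq_eq (MeasurableSet.iUnion hA)]
        simp_rw [fun n => E.norm_sq_eq (hA n) ψ]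
        exact hs
      rw [← hs'.tsum_eq]
      exact ENNReal.ofReal_tsum_of_nonneg (fun n => by positivity) hs'.summable)

/-- `g(E)ψ = ∑ c • E(g = c)ψ` for a simple function `g`. -/
def simpleIntegral (E : SpectralMeasure X 𝓗) (g : SimpleFunc X ℂ) (ψ : 𝓗) : 𝓗 :=
  ∑ c ∈ g.range, c • E.proj (g ⁻¹' {c}) ψ

/-- The domain of the operator `f(E) = ∫ f dE`: all `ψ` with `∫ |f|² d⟨ψ, Eψ⟩ < ∞`. -/
def dom (E : SpectralMeasure X 𝓗) (f : X → ℂ) : Set 𝓗 :=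
  {ψ | MemLp f 2 (E.measure ψ)}

/-- The vector `f(E)ψ = (∫ f dE)ψ`, for `ψ` in the domain: the limit of `g(E)ψ` as the simple
function `g` tends to `f` in `L²(⟨ψ, Eψ⟩)`. -/
def integral (E : SpectralMeasure X 𝓗) (f : X → ℂ) (ψ : 𝓗) : 𝓗 :=
  limUnder
    (comap (fun g : SimpleFunc X ℂ => eLpNorm (fun x => f x - g x) 2 (E.measure ψ)) (𝓝 0))
    (fun g => E.simpleIntegral g ψ)

end SpectralMeasure

section Particle

variable {𝓗 : Type*} [NormedAddCommGroup 𝓗] [InnerProductSpace ℂ 𝓗] [CompleteSpace 𝓗]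

/-- `E` is the joint spectral measure of the operators `R¹, …, Rᵈ`, that is `Rᵅ = ∫ xᵅ dE(x)`
with equality of domains. (A finite family of self-adjoint operators has one if and only if the
operators commute in the strong sense.) -/
def IsJointSpectralMeasure {d : ℕ} (R : Fin d → (𝓗 →ₗ.[ℂ] 𝓗))
    (E : SpectralMeasure (Coord d) 𝓗) : Prop :=
  ∀ α, (∀ ψ, ψ ∈ (R α).domain ↔ ψ ∈ E.dom (fun x => ((x α : ℝ) : ℂ))) ∧
    ∀ ψ : (R α).domain, R α ψ = E.integral (fun x => ((x α : ℝ) : ℂ)) (ψ : 𝓗)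

/-! ### The free propagator `exp(-iHt/ħ)` -/

/-- `U` is the strongly continuous unitary group with generator exactly `-(i/ħ)H`. -/
structure IsUnitaryGroupOf (H : 𝓗 →ₗ.[ℂ] 𝓗) (hbar : ℝ) (U : ℝ → 𝓗 →L[ℂ] 𝓗) : Prop where
  unitary : ∀ t, U t ∈ unitary (𝓗 →L[ℂ] 𝓗)
  zero : U 0 = 1
  add : ∀ s t, U (s + t) = U s * U t
  continuous : ∀ ψ, Continuous fun t => U t ψ
  mem_domain_iff : ∀ ψ, ψ ∈ H.domain ↔ DifferentiableAt ℝ (fun t => U t ψ) 0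
  hasDerivAt : ∀ ψ : H.domain,
    HasDerivAt (fun t => U t (ψ : 𝓗)) (-(Complex.I / (hbar : ℂ)) • H ψ) 0

open Classical in
/-- `U(t) = exp(-iHt/ħ)`: the unitary group with generator `-(i/ħ)H`. For a self-adjoint `H` there
is exactly one such group; the value in the other case is irrelevant. -/
def propagator (H : 𝓗 →ₗ.[ℂ] 𝓗) (hbar : ℝ) : ℝ → 𝓗 →L[ℂ] 𝓗 :=
  if h : ∃ U, IsUnitaryGroupOf H hbar U then h.choose else 0

end Particle

/-! ### The pointer -/

/-- The pointer scale: all of `ℝᵈ`, or the lattice `εℤᵈ`. -/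
inductive PointerScale : Type
  | continuum : PointerScale
  | lattice (ε : ℝ) (hε : 0 < ε) : PointerScale

namespace PointerScale

/-- The set `Λ` of pointer values. -/
def points (d : ℕ) : PointerScale → Set (Coord d)
  | continuum => univ
  | lattice ε _ => {y | ∀ α, ∃ n : ℤ, y α = ε * n}

/-- The measure `λ` of `Λ`, as a measure on `ℝᵈ` concentrated on `Λ`: Lebesgue measure, or mass
`εᵈ` at every lattice point. -/
def volumeMeasure (d : ℕ) : PointerScale → Measure (Coord d)
  | continuum => volume
  | lattice ε hε =>
      ENNReal.ofReal (ε ^ d) • Measure.count.restrict ((lattice ε hε).points d)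

end PointerScale

/-- The input distribution `dμ₀ = |f₀|² dλ` of the pointer value. -/
def inputMeasure {d : ℕ} (Λ : PointerScale) (f₀ : Coord d → ℂ) : Measure (Coord d) :=
  (Λ.volumeMeasure d).withDensity fun y => ENNReal.ofReal (‖f₀ y‖ ^ 2)

/-! ### The single kick -/

/-- The unit step `1_t`: one for `t > 0`, zero for `t ≤ 0`. -/
def unitStep (t : ℝ) : ℝ := if 0 < t then 1 else 0

/-- The measure `d1_t` on the time axis. -/
def kickMeasure : Measure ℝ := Measure.dirac 0

/-- `d1_t` gives to `[a, b)` the forward increment `1_b - 1_a`. -/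
theorem kickMeasure_Ico {a b : ℝ} (h : a ≤ b) :
    kickMeasure (Ico a b) = ENNReal.ofReal (unitStep b - unitStep a) := by
  unfold kickMeasure unitStep
  rw [Measure.dirac_apply' _ measurableSet_Ico]
  by_cases ha : 0 < a
  · have hb : 0 < b := ha.trans_le h
    simp [ha, hb]
  · by_cases hb : 0 < b
    · simp [ha, hb, not_lt.mp ha]
    · simp [ha, hb]

/-- `J` is the Itô integral `∫_{[s,t]} B(r) da(r)` of a stochastic vector process `B` on the
probability space `(Y, μ)`: the mean square limit, as the mesh of the partition
`s = p₀ ≤ … ≤ pₙ = t` tends to zero, of the sums `∑ (a(pᵢ₊₁) - a(pᵢ)) B(pᵢ)` made with the forward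
increments of the integrator. -/
def IsItoIntegral {𝓗 : Type*} [NormedAddCommGroup 𝓗] [InnerProductSpace ℂ 𝓗]
    {Y : Type*} [MeasurableSpace Y] (μ : Measure Y) (a : ℝ → ℝ) (B : ℝ → Y → 𝓗) (s t : ℝ)
    (J : Y → 𝓗) : Prop :=
  ∀ ε : ℝ, 0 < ε → ∃ δ : ℝ, 0 < δ ∧ ∀ (n : ℕ) (p : ℕ → ℝ), Monotone p → p 0 = s → p n = t →
    (∀ i < n, p (i + 1) - p i < δ) →
      eLpNorm (fun y => (∑ i ∈ Finset.range n, ((a (p (i + 1)) - a (p i) : ℝ) : ℂ) • B (p i) y) - J y)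
        2 μ ≤ ENNReal.ofReal ε

section Reduction

variable {𝓗 : Type*} [NormedAddCommGroup 𝓗] [InnerProductSpace ℂ 𝓗] [CompleteSpace 𝓗] {d : ℕ}

/-- The function `x ↦ f₀(y - κx) / f₀(y)`, whose value at `R` is the reduction operator. -/
def reductionSymbol (f₀ : Coord d → ℂ) (κ : ℝ) (y x : Coord d) : ℂ :=
  f₀ (y - κ • x) / f₀ y

/-- `G(y) = f₀(yI - κR) / f₀(y)`, where `E` is the joint spectral measure of `R`. -/
def reductionOp (E : SpectralMeasure (Coord d) 𝓗) (f₀ : Coord d → ℂ) (κ : ℝ) (y : Coord d) :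
    𝓗 → 𝓗 :=
  E.integral (reductionSymbol f₀ κ y)

/-- `G_t(y) = f₀(yI - κR_t) / f₀(y)`, where `R_t = 1_t R`; this is the identity for `t ≤ 0` and `G(y)` for
`t > 0`, whenever `f₀(y) ≠ 0`. -/
def reductionOpAt (E : SpectralMeasure (Coord d) 𝓗) (f₀ : Coord d → ℂ) (κ t : ℝ) (y : Coord d) :
    𝓗 → 𝓗 :=
  E.integral (fun x => reductionSymbol f₀ κ y (unitStep t • x))

/-- `G_t(r, y) = U(r)† G_t(y) U(r)`. -/
def reductionOpHeis (H : 𝓗 →ₗ.[ℂ] 𝓗) (hbar : ℝ) (E : SpectralMeasure (Coord d) 𝓗)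
    (f₀ : Coord d → ℂ) (κ t r : ℝ) (y : Coord d) (ψ : 𝓗) : 𝓗 :=
  ContinuousLinearMap.adjoint (propagator H hbar r)
    (reductionOpAt E f₀ κ t y (propagator H hbar r ψ))

/-- The stochastic vector `χ(t, y) = T(t, y)η`, where `T(t, y) = U(t - t₀) G_t(-t₀, y)`. -/
def reducedState (H : 𝓗 →ₗ.[ℂ] 𝓗) (hbar : ℝ) (E : SpectralMeasure (Coord d) 𝓗)
    (f₀ : Coord d → ℂ) (κ t₀ : ℝ) (η : 𝓗) (t : ℝ) (y : Coord d) : 𝓗 :=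
  propagator H hbar (t - t₀) (reductionOpHeis H hbar E f₀ κ t (-t₀) y η)

/-- The integrand `[G - I](y) χ(r, y)` of the kick term. -/
def kickIntegrand (E : SpectralMeasure (Coord d) 𝓗) (f₀ : Coord d → ℂ) (κ : ℝ)
    (χ : ℝ → Coord d → 𝓗) (r : ℝ) (y : Coord d) : 𝓗 :=
  reductionOp E f₀ κ y (χ r y) - χ r y

/-- The kick term `∫_{t₀}^t d1_r [G - I](y) χ(r, y)`, for every fixed `y`. -/
def kickTerm (E : SpectralMeasure (Coord d) 𝓗) (f₀ : Coord d → ℂ) (κ t₀ : ℝ)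
    (χ : ℝ → Coord d → 𝓗) (t : ℝ) (y : Coord d) : 𝓗 :=
  ∫ r in Ico t₀ t, kickIntegrand E f₀ κ χ r y ∂kickMeasure

/-- The process `χ` satisfies `dχ + (i/ħ) H χ dt = d1_t [G - I] χ`, `χ(t₀) = η`, in the sense of
Itô, on the probability space of the pointer value `y` with distribution `μ₀`. -/
structure SolvesSingleKick (H : 𝓗 →ₗ.[ℂ] 𝓗) (hbar : ℝ) (E : SpectralMeasure (Coord d) 𝓗)
    (f₀ : Coord d → ℂ) (κ : ℝ) (μ₀ : Measure (Coord d)) (t₀ : ℝ) (η : 𝓗)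
    (χ : ℝ → Coord d → 𝓗) : Prop where
  /-- `χ` is a mean square integrable stochastic vector process -/
  memLp : ∀ t, t₀ ≤ t → MemLp (χ t) 2 μ₀
  /-- initial condition -/
  initial : ∀ᵐ y ∂μ₀, χ t₀ y = η
  /-- up to and including the instant of the kick, `χ(r)` is in the domain of `G` -/
  mem_dom : ∀ r, t₀ ≤ r → r ≤ 0 → ∀ᵐ y ∂μ₀, χ r y ∈ E.dom (reductionSymbol f₀ κ y)
  /-- the kick term is an Itô integral -/
  ito : ∀ t, t₀ ≤ t →
    IsItoIntegral μ₀ unitStep (kickIntegrand E f₀ κ χ) t₀ t (kickTerm E f₀ κ t₀ χ t)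
  /-- the equation, for every initial vector:
  `χ(t) - η + (i/ħ) H ∫_{t₀}^t χ ds = ∫_{t₀}^t d1_r [G - I] χ(r)` -/
  equation : ∀ᵐ y ∂μ₀, ∀ t, t₀ ≤ t →
    IntervalIntegrable (fun s => χ s y) volume t₀ t ∧
    ∃ hw : (∫ s in t₀..t, χ s y) ∈ H.domain,
      χ t y - η + (Complex.I / (hbar : ℂ)) • H ⟨∫ s in t₀..t, χ s y, hw⟩ = kickTerm E f₀ κ t₀ χ t y
  /-- the equation in its literal form, `χ(t) - η + (i/ħ) ∫_{t₀}^t H χ ds = ∫_{t₀}^t d1_r [G - I] χ(r)`,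
  wherever `χ` stays in the domain of `H` (`Hχ s` is then the vector `H χ(s, y)`) -/
  strong : ∀ᵐ y ∂μ₀, ∀ t, t₀ ≤ t → ∀ Hχ : ℝ → 𝓗,
    (∀ s ∈ Icc t₀ t, (χ s y, Hχ s) ∈ H.graph) →
      IntervalIntegrable Hχ volume t₀ t ∧
      χ t y - η + (Complex.I / (hbar : ℂ)) • (∫ s in t₀..t, Hχ s) = kickTerm E f₀ κ t₀ χ t y
  /-- the equation solved with respect to the free evolution:
  `χ(t) = e^{-iHt/ħ} (e^{iHt₀/ħ} η + ∫_{t₀}^t e^{iHr/ħ} d1_r [G - I] χ(r))` -/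
  mild : ∀ᵐ y ∂μ₀, ∀ t, t₀ ≤ t →
    χ t y = propagator H hbar t (propagator H hbar (-t₀) η +
      ∫ r in Ico t₀ t, propagator H hbar (-r) (kickIntegrand E f₀ κ χ r y) ∂kickMeasure)

end Reduction

end

noncomputable section

/-! ### Unitary groups with bounded skew-adjoint generators -/

section BoundedGenerator

variable {𝓗 : Type*} [NormedAddCommGroup 𝓗] [InnerProductSpace ℂ 𝓗] [CompleteSpace 𝓗]

/-! Put `ξ = U(-t₀)η`. Where `f₀(y) ≠ 0`, hence `μ₀`-almost everywhere, `χ(t, y)` is `U(t)ξ` for `t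
≤ 0` and `U(t)G(y)ξ` for `t > 0`: two free orbits, separated by the jump `(G(y) - I)ξ` at time `0`.
The Dirac measure on `[t₀, t)` picks up the integrand at `0`, where `χ` still has its pre-kick value
`ξ`, so the kick term is exactly this jump once `t > 0`, and zero before. The three forms of the
equation are then identities for free orbits: `∫ₐᵇ U(s)φ ds` lies in the domain of `H` for every
`φ`, with `(i/ħ)H` of it equal to `U(a)φ - U(b)φ`, and the pieces before and after the kick are
added.

The probabilistic part rests on one estimate. The density `|f₀(y)|²` of `μ₀` cancels the denominator
of `G(y)`, and translation invariance of `λ` with Tonelli's theorem gives `‖G(·)ψ‖ ≤ ‖ψ‖` in `L²(μ₀;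
𝓗)`, together with membership of `ψ` in the domain of `G(y)` for almost every `y`
(`lintegral_eLpNorm_reductionSymbol_le`). In an Itô sum for `t > 0` only the interval containing the
kick survives; it contributes `(G - I)U(pₖ)ξ` with `pₖ → 0`, and the estimate with strong continuity
of `U` gives the limit.

Two foundations are needed. Since `propagator` is chosen from an existence statement, Stone's
theorem is proved, by bounded commuting approximations of `H`. The calculus `∫ f dE` is obtained
from the isometry of simple functions into `𝓗` (`enorm_simpleIntegral`). -/

theorem norm_apply_of_mem_unitary {V : 𝓗 →L[ℂ] 𝓗} (hV : V ∈ unitary (𝓗 →L[ℂ] 𝓗)) (v : 𝓗) :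
    ‖V v‖ = ‖v‖ := by
  have h := (ContinuousLinearMap.norm_map_iff_adjoint_comp_self V).2 (Unitary.star_mul_self_of_mem hV)
  exact h v

theorem exp_smul_mem_unitary {B : 𝓗 →L[ℂ] 𝓗} (hB : B ∈ skewAdjoint (𝓗 →L[ℂ] 𝓗)) (t : ℝ) :
    NormedSpace.exp (t • B) ∈ unitary (𝓗 →L[ℂ] 𝓗) :=
  let _ : NormedAlgebra ℚ (𝓗 →L[ℂ] 𝓗) := .restrictScalars ℚ ℂ _
  NormedSpace.exp_mem_unitary_of_mem_skewAdjoint (skewAdjoint.smul_mem t hB)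

theorem exp_add_smul (B : 𝓗 →L[ℂ] 𝓗) (s t : ℝ) :
    NormedSpace.exp ((s + t) • B) = NormedSpace.exp (s • B) * NormedSpace.exp (t • B) := by
  let _ : NormedAlgebra ℚ (𝓗 →L[ℂ] 𝓗) := .restrictScalars ℚ ℂ _
  rw [add_smul]
  exact NormedSpace.exp_add_of_commute (((Commute.refl B).smul_left s).smul_right t)

theorem norm_exp_smul_apply {B : 𝓗 →L[ℂ] 𝓗} (hB : B ∈ skewAdjoint (𝓗 →L[ℂ] 𝓗)) (t : ℝ) (v : 𝓗) :
    ‖NormedSpace.exp (t • B) v‖ = ‖v‖ :=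
  norm_apply_of_mem_unitary (exp_smul_mem_unitary hB t) v

theorem hasDerivAt_exp_smul_apply (B : 𝓗 →L[ℂ] 𝓗) (v : 𝓗) (t : ℝ) :
    HasDerivAt (fun s : ℝ => NormedSpace.exp (s • B) v) (NormedSpace.exp (t • B) (B v)) t := by
  have h := hasDerivAt_exp_smul_const (𝕂 := ℝ) B t
  exact (((ContinuousLinearMap.apply ℂ 𝓗 v).restrictScalars ℝ).hasFDerivAt.comp_hasDerivAt t h)

/-- Mean value inequality: the derivative `exp(sB)Bv` has constant norm `‖Bv‖`. -/
theorem norm_exp_smul_apply_sub_le {B : 𝓗 →L[ℂ] 𝓗} (hB : B ∈ skewAdjoint (𝓗 →L[ℂ] 𝓗)) (t : ℝ)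
    (v : 𝓗) : ‖NormedSpace.exp (t • B) v - v‖ ≤ |t| * ‖B v‖ := by
  have h := (convex_univ (𝕜 := ℝ) (E := ℝ)).norm_image_sub_le_of_norm_hasDerivWithin_le
    (fun s _ => (hasDerivAt_exp_smul_apply B v s).hasDerivWithinAt)
    (fun s _ => (norm_exp_smul_apply hB s (B v)).le) (mem_univ (0 : ℝ)) (mem_univ t)
  simpa [mul_comm] using h

/-- Commutation allows the factorization `exp(tB) = exp(tC) exp(t(B - C))`; the isometry `exp(tC)`
drops out. Strong convergence of generators thus passes to their groups. -/
theorem norm_exp_smul_apply_sub_exp_smul_apply_le {B C : 𝓗 →L[ℂ] 𝓗}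
    (hB : B ∈ skewAdjoint (𝓗 →L[ℂ] 𝓗)) (hC : C ∈ skewAdjoint (𝓗 →L[ℂ] 𝓗)) (hBC : Commute B C)
    (t : ℝ) (v : 𝓗) :
    ‖NormedSpace.exp (t • B) v - NormedSpace.exp (t • C) v‖ ≤ |t| * ‖B v - C v‖ := by
  let _ : NormedAlgebra ℚ (𝓗 →L[ℂ] 𝓗) := .restrictScalars ℚ ℂ _
  have hc : Commute (t • C) (t • (B - C)) :=
    ((hBC.symm.sub_right (Commute.refl C)).smul_left t).smul_right t
  have he : NormedSpace.exp (t • B) = NormedSpace.exp (t • C) * NormedSpace.exp (t • (B - C)) := by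
    rw [← NormedSpace.exp_add_of_commute hc, ← smul_add, add_sub_cancel]
  rw [he, mul_apply_eq_comp, ← map_sub, norm_exp_smul_apply hC]
  exact norm_exp_smul_apply_sub_le (sub_mem hB hC) t v

/-- The auxiliary vector `w` avoids `B(Bv)`, which is not controlled along a sequence of generators.
Taking `w` in the dense set, near the limit of `Bv`, keeps the bound meaningful in the limit. -/
theorem norm_exp_smul_apply_sub_sub_le {B : 𝓗 →L[ℂ] 𝓗} (hB : B ∈ skewAdjoint (𝓗 →L[ℂ] 𝓗)) (t : ℝ)
    (v w : 𝓗) :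
    ‖NormedSpace.exp (t • B) v - v - t • B v‖ ≤ (2 * ‖B v - w‖ + |t| * ‖B w‖) * |t| := by
  have hd : ∀ s : ℝ, HasDerivAt (fun s : ℝ => NormedSpace.exp (s • B) v - s • B v)
      (NormedSpace.exp (s • B) (B v) - B v) s := fun s => by
    have h := (hasDerivAt_exp_smul_apply B v s).sub ((hasDerivAt_id s).smul_const (B v))
    rwa [one_smul] at h
  have hb : ∀ s ∈ uIcc 0 t, ‖NormedSpace.exp (s • B) (B v) - B v‖ ≤
      2 * ‖B v - w‖ + |t| * ‖B w‖ := fun s hs => by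
    have hst : |s| ≤ |t| := by simpa using abs_sub_left_of_mem_uIcc hs
    calc ‖NormedSpace.exp (s • B) (B v) - B v‖
        = ‖NormedSpace.exp (s • B) (B v - w) - (B v - w) + (NormedSpace.exp (s • B) w - w)‖ := by
          rw [map_sub]; congr 1; abel
      _ ≤ ‖NormedSpace.exp (s • B) (B v - w)‖ + ‖B v - w‖ + ‖NormedSpace.exp (s • B) w - w‖ :=
          (norm_add_le _ _).trans (add_le_add_left (norm_sub_le _ _) _)
      _ ≤ ‖B v - w‖ + ‖B v - w‖ + |t| * ‖B w‖ := by
          rw [norm_exp_smul_apply hB]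
          gcongr
          exact (norm_exp_smul_apply_sub_le hB s w).trans (by gcongr)
      _ = _ := by ring
  have h := (convex_uIcc (0 : ℝ) t).norm_image_sub_le_of_norm_hasDerivWithin_le
    (fun s _ => (hd s).hasDerivWithinAt) hb left_mem_uIcc right_mem_uIcc
  have e : NormedSpace.exp (t • B) v - t • B v - (NormedSpace.exp ((0 : ℝ) • B) v - (0 : ℝ) • B v)
      = NormedSpace.exp (t • B) v - v - t • B v := by
    simp; abel
  rwa [e, sub_zero, Real.norm_eq_abs] at h

end BoundedGenerator

/-! ### Strong limits of commuting unitary groups -/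

section StrongLimit

variable {𝓗 : Type*} [NormedAddCommGroup 𝓗] [InnerProductSpace ℂ 𝓗]

theorem cauchySeq_apply_of_dense {D : Set 𝓗} (hD : Dense D) {T : ℕ → 𝓗 →L[ℂ] 𝓗}
    (hT : ∀ n v, ‖T n v‖ ≤ ‖v‖) (h : ∀ v ∈ D, CauchySeq fun n => T n v) (v : 𝓗) :
    CauchySeq fun n => T n v := by
  rw [Metric.cauchySeq_iff]
  intro ε hε
  obtain ⟨w, hw, hvw⟩ := Metric.dense_iff.1 hD v (ε / 3) (by positivity)
  obtain ⟨N, hN⟩ := Metric.cauchySeq_iff.1 (h w hvw) (ε / 3) (by positivity)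
  refine ⟨N, fun m hm n hn => ?_⟩
  have h1 := hN m hm n hn
  have h2 : ‖v - w‖ < ε / 3 := by rw [← dist_eq_norm, dist_comm]; exact hw
  rw [dist_eq_norm] at h1 ⊢
  have h3 := hT m (v - w)
  have h4 := hT n (v - w)
  have e : T m v - T n v = T m (v - w) + (T m w - T n w) - T n (v - w) := by
    simp only [map_sub]; abel
  rw [e]
  have h5 := norm_sub_le (T m (v - w) + (T m w - T n w)) (T n (v - w))
  have h6 := norm_add_le (T m (v - w)) (T m w - T n w)
  linarith

theorem tendsto_apply_of_dense {ι : Type*} {l : Filter ι} {D : Set 𝓗} (hD : Dense D)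
    {T : ι → 𝓗 →L[ℂ] 𝓗} {S : 𝓗 →L[ℂ] 𝓗}
    (hT : ∀ n v, ‖T n v‖ ≤ ‖v‖) (hS : ∀ v, ‖S v‖ ≤ ‖v‖)
    (h : ∀ v ∈ D, Tendsto (fun n => T n v) l (𝓝 (S v))) (v : 𝓗) :
    Tendsto (fun n => T n v) l (𝓝 (S v)) := by
  rw [Metric.tendsto_nhds]
  intro ε hε
  obtain ⟨w, hw, hvw⟩ := Metric.dense_iff.1 hD v (ε / 3) (by positivity)
  filter_upwards [Metric.tendsto_nhds.1 (h w hvw) (ε / 3) (by positivity)] with m h1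
  have h2 : ‖v - w‖ < ε / 3 := by rw [← dist_eq_norm, dist_comm]; exact hw
  rw [dist_eq_norm] at h1 ⊢
  have h3 := hT m (v - w)
  have h4 := hS (v - w)
  have e : T m v - S v = T m (v - w) + (T m w - S w) - S (v - w) := by
    simp only [map_sub]; abel
  rw [e]
  have h5 := norm_sub_le (T m (v - w) + (T m w - S w)) (S (v - w))
  have h6 := norm_add_le (T m (v - w)) (T m w - S w)
  linarith

/-- Commuting bounded skew-adjoint operators which converge strongly on a dense set `D` generate
unitary groups which converge strongly to a unitary group; the limit of the generators is its
derivative on `D`. -/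
theorem exists_unitary_group_of_tendsto [CompleteSpace 𝓗] {B : ℕ → 𝓗 →L[ℂ] 𝓗}
    (hB : ∀ n, B n ∈ skewAdjoint (𝓗 →L[ℂ] 𝓗)) (hcomm : ∀ m n, Commute (B m) (B n))
    {D : Set 𝓗} (hD : Dense D) {L : 𝓗 → 𝓗}
    (hL : ∀ v ∈ D, Tendsto (fun n => B n v) atTop (𝓝 (L v))) :
    ∃ U : ℝ → 𝓗 →L[ℂ] 𝓗, (∀ t, U t ∈ unitary (𝓗 →L[ℂ] 𝓗)) ∧ U 0 = 1 ∧
      (∀ s t, U (s + t) = U s * U t) ∧ (∀ v, Continuous fun t => U t v) ∧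
      ∀ v ∈ D, HasDerivAt (fun t => U t v) (L v) 0 := by
  set V : ℕ → ℝ → 𝓗 →L[ℂ] 𝓗 := fun n t => NormedSpace.exp (t • B n) with hV
  have hVn : ∀ n t v, ‖V n t v‖ = ‖v‖ := fun n t v => norm_exp_smul_apply (hB n) t v
  have hcau : ∀ t v, CauchySeq fun n => V n t v := fun t => by
    refine cauchySeq_apply_of_dense hD (fun n v => (hVn n t v).le) fun v hv => ?_
    have hc := (hL v hv).cauchySeq
    rw [Metric.cauchySeq_iff] at hc ⊢
    intro ε hε
    obtain ⟨N, hN⟩ := hc (ε / (|t| + 1)) (by positivity)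
    refine ⟨N, fun m hm n hn => ?_⟩
    have h1 := hN m hm n hn
    rw [dist_eq_norm] at h1 ⊢
    refine (norm_exp_smul_apply_sub_exp_smul_apply_le (hB m) (hB n) (hcomm m n) t v).trans_lt ?_
    rw [lt_div_iff₀ (by positivity)] at h1
    nlinarith [norm_nonneg (B m v - B n v), abs_nonneg t]
  choose W hW using fun t v => cauchySeq_tendsto_of_complete (hcau t v)
  have hWn : ∀ t v, ‖W t v‖ = ‖v‖ := fun t v =>
    tendsto_nhds_unique (hW t v).norm (by simp only [hVn]; exact tendsto_const_nhds)
  let U : ℝ → 𝓗 →L[ℂ] 𝓗 := fun t => LinearMap.mkContinuous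
    { toFun := W t
      map_add' := fun v w => tendsto_nhds_unique (hW t (v + w))
        (by simpa only [map_add] using (hW t v).add (hW t w))
      map_smul' := fun c v => tendsto_nhds_unique (hW t (c • v))
        (by simpa only [map_smul, RingHom.id_apply] using (hW t v).const_smul c) } 1
    (fun v => by simp [hWn])
  have hU : ∀ t v, Tendsto (fun n => V n t v) atTop (𝓝 (U t v)) := hW
  have hUn : ∀ t v, ‖U t v‖ = ‖v‖ := hWn
  have hzero : U 0 = 1 := by
    ext v
    exact tendsto_nhds_unique (hU 0 v) (by simp [hV])
  have hadd : ∀ s t, U (s + t) = U s * U t := fun s t => by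
    ext v
    refine tendsto_nhds_unique (hU (s + t) v) ?_
    have h1 : ∀ n, V n (s + t) v = V n s (V n t v - U t v) + V n s (U t v) := fun n => by
      rw [← map_add, sub_add_cancel]
      simp only [hV, exp_add_smul, mul_apply_eq_comp]
    simp only [h1]
    have h2 : Tendsto (fun n => V n s (V n t v - U t v)) atTop (𝓝 0) := by
      rw [tendsto_zero_iff_norm_tendsto_zero]
      simp only [hVn]
      exact (tendsto_iff_norm_sub_tendsto_zero).1 (hU t v)
    simpa using h2.add (hU s (U t v))
  -- A strong limit of unitaries is in general only an isometry; the group law supplies the inverse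
  -- `U(-t)`.
  have hunit : ∀ t, U t ∈ unitary (𝓗 →L[ℂ] 𝓗) := fun t => by
    have h1 : star (U t) * U t = 1 :=
      (ContinuousLinearMap.norm_map_iff_adjoint_comp_self (U t)).1 (hUn t)
    have h2 : U t * U (-t) = 1 := by rw [← hadd, add_neg_cancel, hzero]
    have h3 : star (U t) = U (-t) := by
      rw [← mul_one (star (U t)), ← h2, ← mul_assoc, h1, one_mul]
    exact Unitary.mem_iff.2 ⟨h1, by rw [h3, h2]⟩
  have hle : ∀ v ∈ D, ∀ t, ‖U t v - v‖ ≤ |t| * ‖L v‖ := fun v hv t =>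
    le_of_tendsto_of_tendsto' ((hU t v).sub_const v).norm ((hL v hv).norm.const_mul |t|)
      fun n => norm_exp_smul_apply_sub_le (hB n) t v
  have hcont0 : ∀ v, Tendsto (fun t => U t v) (𝓝 0) (𝓝 v) := fun v => by
    refine tendsto_apply_of_dense (S := 1) hD (fun t v => (hUn t v).le) (fun v => le_rfl)
      (fun w hw => ?_) v
    rw [tendsto_iff_norm_sub_tendsto_zero]
    refine squeeze_zero (fun _ => norm_nonneg _) (hle w hw) ?_
    have : Continuous fun t : ℝ => |t| * ‖L w‖ := by fun_prop
    simpa using this.tendsto 0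
  have hcont : ∀ v, Continuous fun t => U t v := fun v => by
    rw [continuous_iff_continuousAt]
    intro s
    have h1 : Tendsto (fun t : ℝ => t - s) (𝓝 s) (𝓝 0) := by
      have : Continuous fun t : ℝ => t - s := by fun_prop
      simpa using this.tendsto s
    have h2 := (((U s).continuous.tendsto v).comp ((hcont0 v).comp h1))
    refine h2.congr fun t => ?_
    simp only [Function.comp]
    rw [← mul_apply_eq_comp, ← hadd, add_sub_cancel]
  refine ⟨U, hunit, hzero, hadd, hcont, fun v hv => ?_⟩
  -- The bound for the approximating groups survives the limit and is uniform enough to give the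
  -- derivative: `w` near `L v` makes the first term small, then small `t` the second.
  have hest : ∀ w ∈ D, ∀ t, ‖U t v - v - t • L v‖ ≤ (2 * ‖L v - w‖ + |t| * ‖L w‖) * |t| :=
    fun w hw t => le_of_tendsto_of_tendsto'
      (((hU t v).sub_const v).sub ((hL v hv).const_smul t)).norm
      ((((((hL v hv).sub_const w).norm.const_mul 2)).add ((hL w hw).norm.const_mul |t|)).mul_const |t|)
      fun n => norm_exp_smul_apply_sub_sub_le (hB n) t v w
  rw [hasDerivAt_iff_isLittleO, Asymptotics.isLittleO_iff]
  intro ε hε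
  obtain ⟨w, hw, hwD⟩ := Metric.dense_iff.1 hD (L v) (ε / 4) (by positivity)
  have h2 : ‖L v - w‖ < ε / 4 := by rw [← dist_eq_norm, dist_comm]; exact hw
  have h3 : ∀ᶠ t : ℝ in 𝓝 0, |t| * ‖L w‖ < ε / 2 := by
    have : Continuous fun t : ℝ => |t| * ‖L w‖ := by fun_prop
    exact (this.tendsto 0).eventually_lt_const (by simpa using half_pos hε)
  filter_upwards [h3] with t ht
  have h4 := hest w hwD t
  simp only [hzero, one_apply_eq_self, sub_zero, Real.norm_eq_abs]
  refine h4.trans ?_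
  gcongr
  linarith

end StrongLimit

/-! ### Resolvents of a self-adjoint operator and Stone's theorem -/

section Resolvent

variable {𝓗 : Type*} [NormedAddCommGroup 𝓗] [InnerProductSpace ℂ 𝓗] [CompleteSpace 𝓗]
  {H : 𝓗 →ₗ.[ℂ] 𝓗}

namespace IsSelfAdjoint

theorem inner_apply_left (hH : IsSelfAdjoint H) (x y : H.domain) :
    inner ℂ (H x) (y : 𝓗) = inner ℂ (x : 𝓗) (H y) := by
  have h := LinearPMap.adjoint_isFormalAdjoint (T := H) hH.dense_domain
  rw [LinearPMap.isSelfAdjoint_def.1 hH] at h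
  exact h x y

theorem mem_graph_of_forall_inner (hH : IsSelfAdjoint H) {x w : 𝓗}
    (h : ∀ y : H.domain, inner ℂ w (y : 𝓗) = inner ℂ x (H y)) : (x, w) ∈ H.graph := by
  have hx : x ∈ (LinearPMap.adjoint H).domain :=
    LinearPMap.mem_adjoint_domain_of_exists x ⟨w, h⟩
  have hw : LinearPMap.adjoint H ⟨x, hx⟩ = w :=
    LinearPMap.adjoint_apply_eq hH.dense_domain ⟨x, hx⟩ h
  have hg : (x, w) ∈ (LinearPMap.adjoint H).graph :=
    (LinearPMap.mem_graph_iff _).2 ⟨⟨x, hx⟩, rfl, hw⟩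
  rwa [LinearPMap.isSelfAdjoint_def.1 hH] at hg

/-- The cross term vanishes because `⟨Hx, x⟩` is real. Closed range, injectivity and the bound of `H
+ ic` all follow from this identity. -/
theorem norm_sq_add_I_smul (hH : IsSelfAdjoint H) (c : ℝ) {p : 𝓗 × 𝓗} (hp : p ∈ H.graph) :
    ‖p.2 + (Complex.I * c) • p.1‖ ^ 2 = ‖p.2‖ ^ 2 + c ^ 2 * ‖p.1‖ ^ 2 := by
  obtain ⟨x, hx1, hx2⟩ := (LinearPMap.mem_graph_iff _).1 hp
  have hsymm : inner ℂ p.2 p.1 = inner ℂ p.1 p.2 := by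
    rw [← hx1, ← hx2]; exact hH.inner_apply_left x x
  have him : (inner ℂ p.2 p.1 : ℂ).im = 0 := by
    have h1 := inner_conj_symm (𝕜 := ℂ) p.2 p.1
    rw [← hsymm] at h1
    exact Complex.conj_eq_iff_im.1 h1
  rw [@norm_add_sq ℂ, inner_smul_right, norm_smul]
  simp [him, mul_pow]

theorem exists_graph_add_I_smul_eq (hH : IsSelfAdjoint H) {c : ℝ} (hc : c ≠ 0) (v : 𝓗) :
    ∃ p ∈ H.graph, p.2 + (Complex.I * c) • p.1 = v := by
  have hcl : IsClosed (H.graph : Set (𝓗 × 𝓗)) := hH.isClosed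
  have : CompleteSpace H.graph := hcl.completeSpace_coe
  let T : H.graph →L[ℂ] 𝓗 :=
    (ContinuousLinearMap.snd ℂ 𝓗 𝓗 + (Complex.I * c) • ContinuousLinearMap.fst ℂ 𝓗 𝓗).comp
      H.graph.subtypeL
  have hT : ∀ p : H.graph, T p = (p : 𝓗 × 𝓗).2 + (Complex.I * c) • (p : 𝓗 × 𝓗).1 := fun p => rfl
  have hanti : AntilipschitzWith ⟨max 1 |c|⁻¹, by positivity⟩ T := by
    refine ContinuousLinearMap.antilipschitz_of_bound _ fun p => ?_
    have h := hH.norm_sq_add_I_smul c p.2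
    rw [← hT] at h
    have h1 : ‖(p : 𝓗 × 𝓗).2‖ ≤ ‖T p‖ :=
      le_of_sq_le_sq (by nlinarith [mul_nonneg (sq_nonneg c) (sq_nonneg ‖(p : 𝓗 × 𝓗).1‖)])
        (norm_nonneg _)
    have h2 : |c| * ‖(p : 𝓗 × 𝓗).1‖ ≤ ‖T p‖ :=
      le_of_sq_le_sq (by rw [mul_pow, sq_abs]; nlinarith [sq_nonneg ‖(p : 𝓗 × 𝓗).2‖])
        (norm_nonneg _)
    have h3 : ‖(p : 𝓗 × 𝓗).1‖ ≤ |c|⁻¹ * ‖T p‖ := by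
      rw [inv_mul_eq_div, le_div_iff₀ (abs_pos.2 hc)]; linarith
    change ‖(p : 𝓗 × 𝓗)‖ ≤ max 1 |c|⁻¹ * ‖T p‖
    refine max_le (h3.trans ?_) (h1.trans ?_)
    · gcongr; exact le_max_right _ _
    · exact le_mul_of_one_le_left (norm_nonneg _) (le_max_left _ _)
  have hrange : IsClosed (range T) := hanti.isClosed_range T.uniformContinuous
  have hr : LinearMap.range (T : H.graph →ₗ[ℂ] 𝓗) = ⊤ := by
    have : CompleteSpace (LinearMap.range (T : H.graph →ₗ[ℂ] 𝓗)) :=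
      IsClosed.completeSpace_coe (hs := by rw [LinearMap.coe_range]; exact hrange)
    rw [← Submodule.orthogonal_eq_bot_iff, Submodule.eq_bot_iff]
    intro w hw
    rw [Submodule.mem_orthogonal'] at hw
    -- A vector orthogonal to the range is an eigenvector of `H* = H` with eigenvalue `ic`.
    -- Orthogonality to its own image `2ic w` then forces `w = 0`.
    have hg : (w, (Complex.I * c) • w) ∈ H.graph := by
      refine hH.mem_graph_of_forall_inner fun y => ?_
      have h1 := hw (T ⟨(y, H y), LinearPMap.mem_graph H y⟩) ⟨_, rfl⟩
      rw [hT, inner_add_right, inner_smul_right] at h1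
      rw [inner_smul_left]
      simp only [map_mul, Complex.conj_I, Complex.conj_ofReal]
      linear_combination -h1
    have h2 := hw (T ⟨_, hg⟩) ⟨_, rfl⟩
    rw [hT, inner_add_right, ← two_mul, inner_smul_right, inner_self_eq_norm_sq_to_K] at h2
    simpa [hc] using h2
  obtain ⟨p, hp⟩ : v ∈ LinearMap.range (T : H.graph →ₗ[ℂ] 𝓗) := hr ▸ Submodule.mem_top
  exact ⟨p, p.2, hp⟩

theorem fst_eq_of_add_I_smul_eq (hH : IsSelfAdjoint H) {c : ℝ} (hc : c ≠ 0) {p q : 𝓗 × 𝓗}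
    (hp : p ∈ H.graph) (hq : q ∈ H.graph)
    (h : p.2 + (Complex.I * c) • p.1 = q.2 + (Complex.I * c) • q.1) : p.1 = q.1 := by
  have h1 := hH.norm_sq_add_I_smul c (sub_mem hp hq)
  have h2 : (p - q).2 + (Complex.I * c) • (p - q).1 = 0 := by
    rw [Prod.snd_sub, Prod.fst_sub, smul_sub, ← sub_eq_zero.2 h]; abel
  rw [h2, norm_zero] at h1
  have h3 : 0 < c ^ 2 := by positivity
  have h4 : ‖(p - q).1‖ ^ 2 = 0 := by
    nlinarith [sq_nonneg ‖(p - q).1‖, sq_nonneg ‖(p - q).2‖]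
  exact sub_eq_zero.1 (norm_eq_zero.1 (pow_eq_zero_iff two_ne_zero |>.1 h4))

/-- The resolvent `(H + ic)⁻¹`. -/
theorem exists_resolvent (hH : IsSelfAdjoint H) {c : ℝ} (hc : c ≠ 0) :
    ∃ K : 𝓗 →L[ℂ] 𝓗, (∀ v, (K v, v - (Complex.I * c) • K v) ∈ H.graph) ∧
      ∀ v, |c| * ‖K v‖ ≤ ‖v‖ := by
  choose p hp hpv using hH.exists_graph_add_I_smul_eq hc
  have hb : ∀ v, |c| * ‖(p v).1‖ ≤ ‖v‖ := fun v => by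
    have h := hH.norm_sq_add_I_smul c (hp v)
    rw [hpv] at h
    exact le_of_sq_le_sq (by rw [mul_pow, sq_abs]; nlinarith [sq_nonneg ‖(p v).2‖])
      (norm_nonneg _)
  refine ⟨LinearMap.mkContinuous
    { toFun := fun v => (p v).1
      map_add' := fun v w => hH.fst_eq_of_add_I_smul_eq hc (hp _) (add_mem (hp v) (hp w)) ?_
      map_smul' := fun a v => hH.fst_eq_of_add_I_smul_eq hc (hp _)
        (Submodule.smul_mem _ a (hp v)) ?_ } |c|⁻¹ fun v => ?_, fun v => ?_, hb⟩
  · rw [hpv, Prod.snd_add, Prod.fst_add, smul_add, add_add_add_comm, hpv, hpv]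
  · rw [hpv, Prod.smul_snd, Prod.smul_fst, smul_comm, ← smul_add, hpv]
  · rw [inv_mul_eq_div, le_div_iff₀ (abs_pos.2 hc), mul_comm]
    exact hb v
  · have h : v - (Complex.I * c) • (p v).1 = (p v).2 := by rw [sub_eq_iff_eq_add, hpv]
    change ((p v).1, v - (Complex.I * c) • (p v).1) ∈ H.graph
    rw [h]
    exact hp v

end IsSelfAdjoint

open Classical in
/-- The resolvent `(H + ic)⁻¹` of a self-adjoint operator, for real `c ≠ 0`. -/
def resolventI (H : 𝓗 →ₗ.[ℂ] 𝓗) (c : ℝ) : 𝓗 →L[ℂ] 𝓗 :=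
  if h : ∃ K : 𝓗 →L[ℂ] 𝓗, (∀ v, (K v, v - (Complex.I * c) • K v) ∈ H.graph) ∧
    ∀ v, |c| * ‖K v‖ ≤ ‖v‖ then h.choose else 0

/-- The bounded approximation `H c² (H² + c²)⁻¹` of `H`. -/
def yosida (H : 𝓗 →ₗ.[ℂ] 𝓗) (c : ℝ) : 𝓗 →L[ℂ] 𝓗 :=
  (c ^ 2 / 2 : ℝ) • (resolventI H c + resolventI H (-c))

namespace IsSelfAdjoint

theorem resolventI_mem_graph (hH : IsSelfAdjoint H) {c : ℝ} (hc : c ≠ 0) (v : 𝓗) :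
    (resolventI H c v, v - (Complex.I * c) • resolventI H c v) ∈ H.graph := by
  have h := hH.exists_resolvent hc
  rw [resolventI, dif_pos h]
  exact h.choose_spec.1 v

theorem norm_resolventI_le (hH : IsSelfAdjoint H) {c : ℝ} (hc : c ≠ 0) (v : 𝓗) :
    |c| * ‖resolventI H c v‖ ≤ ‖v‖ := by
  have h := hH.exists_resolvent hc
  rw [resolventI, dif_pos h]
  exact h.choose_spec.2 v

theorem resolventI_add_I_smul (hH : IsSelfAdjoint H) {c : ℝ} (hc : c ≠ 0) {p : 𝓗 × 𝓗}
    (hp : p ∈ H.graph) : resolventI H c (p.2 + (Complex.I * c) • p.1) = p.1 :=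
  hH.fst_eq_of_add_I_smul_eq hc (hH.resolventI_mem_graph hc _) hp (sub_add_cancel _ _)

theorem adjoint_resolventI (hH : IsSelfAdjoint H) {c : ℝ} (hc : c ≠ 0) :
    star (resolventI H c) = resolventI H (-c) := by
  rw [ContinuousLinearMap.star_eq_adjoint, eq_comm, ContinuousLinearMap.eq_adjoint_iff]
  intro w v
  obtain ⟨x, hx1, hx2⟩ := (LinearPMap.mem_graph_iff _).1 (hH.resolventI_mem_graph hc v)
  obtain ⟨y, hy1, hy2⟩ := (LinearPMap.mem_graph_iff _).1
    (hH.resolventI_mem_graph (neg_ne_zero.2 hc) w)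
  simp only at hx1 hx2 hy1 hy2
  have h := hH.inner_apply_left y x
  rw [← hx1] at hx2 ⊢
  rw [← hy1] at hy2 ⊢
  rw [eq_sub_iff_add_eq] at hx2 hy2
  rw [← hx2, ← hy2, inner_add_left, inner_add_right, inner_smul_left, inner_smul_right, h]
  simp

/-- First resolvent identity. Exchanging `a` and `b` in it shows that resolvents commute. -/
theorem resolventI_sub_resolventI (hH : IsSelfAdjoint H) {a b : ℝ} (ha : a ≠ 0) (hb : b ≠ 0) :
    resolventI H a - resolventI H b =
      (Complex.I * (b - a)) • (resolventI H a * resolventI H b) := by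
  ext v
  have h1 := sub_mem (hH.resolventI_mem_graph ha v) (hH.resolventI_mem_graph hb v)
  have h2 := hH.resolventI_add_I_smul ha h1
  simp only [Prod.mk_sub_mk] at h2
  rw [sub_apply, smul_apply, mul_apply_eq_comp, ← map_smul (resolventI H a), ← h2]
  refine congrArg (resolventI H a) ?_
  module

theorem commute_resolventI (hH : IsSelfAdjoint H) {a b : ℝ} (ha : a ≠ 0) (hb : b ≠ 0) :
    Commute (resolventI H a) (resolventI H b) := by
  rcases eq_or_ne a b with rfl | hab
  · exact Commute.refl _
  have h1 := hH.resolventI_sub_resolventI ha hb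
  have h2 := hH.resolventI_sub_resolventI hb ha
  have h3 : (Complex.I * (b - a)) • (resolventI H a * resolventI H b) =
      (Complex.I * (b - a)) • (resolventI H b * resolventI H a) := by
    rw [← h1, ← neg_sub, h2, ← neg_smul]
    congr 1
    ring
  have h4 : Complex.I * ((b : ℂ) - a) ≠ 0 :=
    mul_ne_zero Complex.I_ne_zero (sub_ne_zero.2 (by exact_mod_cast hab.symm))
  exact smul_right_injective _ h4 h3

theorem commute_yosida (hH : IsSelfAdjoint H) {a b : ℝ} (ha : a ≠ 0) (hb : b ≠ 0) :
    Commute (yosida H a) (yosida H b) := by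
  have ha' := neg_ne_zero.2 ha
  have hb' := neg_ne_zero.2 hb
  refine Commute.smul_left (Commute.smul_right ?_ _) _
  exact ((hH.commute_resolventI ha hb).add_right (hH.commute_resolventI ha hb')).add_left
    ((hH.commute_resolventI ha' hb).add_right (hH.commute_resolventI ha' hb'))

theorem star_yosida (hH : IsSelfAdjoint H) {c : ℝ} (hc : c ≠ 0) :
    star (yosida H c) = yosida H c := by
  have h := hH.adjoint_resolventI (neg_ne_zero.2 hc)
  rw [neg_neg] at h
  rw [yosida, star_smul, star_add, hH.adjoint_resolventI hc, h, add_comm, star_trivial]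

/-- On the domain the error is `-(H + ic)⁻¹Hw`, of norm at most `‖Hw‖/|c|`; the operators are
contractions, so density does the rest. -/
theorem tendsto_smul_resolventI (hH : IsSelfAdjoint H) {c : ℕ → ℝ} (hc : ∀ n, c n ≠ 0)
    (hlim : Tendsto (fun n => |c n|) atTop atTop) (v : 𝓗) :
    Tendsto (fun n => (Complex.I * c n) • resolventI H (c n) v) atTop (𝓝 v) := by
  refine tendsto_apply_of_dense (T := fun n => (Complex.I * c n) • resolventI H (c n)) (S := 1)
    hH.dense_domain (fun n v => ?_) (fun v => le_rfl) (fun w hw => ?_) v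
  · simpa [norm_smul] using hH.norm_resolventI_le (hc n) v
  · rw [tendsto_iff_norm_sub_tendsto_zero]
    have h0 : Tendsto (fun n => |c n|⁻¹ * ‖H ⟨w, hw⟩‖) atTop (𝓝 0) := by
      simpa using hlim.inv_tendsto_atTop.mul_const ‖H ⟨w, hw⟩‖
    refine squeeze_zero (fun _ => norm_nonneg _) (fun n => ?_) h0
    have h1 := hH.resolventI_add_I_smul (hc n) (LinearPMap.mem_graph H ⟨w, hw⟩)
    simp only [map_add, map_smul] at h1
    have h2 : ((Complex.I * c n) • resolventI H (c n)) w - (1 : 𝓗 →L[ℂ] 𝓗) w =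
        -resolventI H (c n) (H ⟨w, hw⟩) := by
      rw [smul_apply, one_apply_eq_self]
      nth_rewrite 2 [← h1]
      abel
    rw [h2, norm_neg, inv_mul_eq_div, le_div_iff₀ (abs_pos.2 (hc n)), mul_comm]
    exact hH.norm_resolventI_le (hc n) _

/-- From `ic(H + ic)⁻¹Hx = icx + c²(H + ic)⁻¹x`, the terms `±icx` cancel in the sum over both signs.
The symmetric combination makes the approximation self-adjoint, and each half tends to `Hx` up to
the factor `1/2`. -/
theorem yosida_apply (hH : IsSelfAdjoint H) {c : ℝ} (hc : c ≠ 0) (x : H.domain) :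
    yosida H c (x : 𝓗) = (1 / 2 : ℝ) • ((Complex.I * c) • resolventI H c (H x) +
      (Complex.I * (-c : ℝ)) • resolventI H (-c) (H x)) := by
  have h1 := hH.resolventI_add_I_smul hc (LinearPMap.mem_graph H x)
  have h2 := hH.resolventI_add_I_smul (neg_ne_zero.2 hc) (LinearPMap.mem_graph H x)
  simp only [map_add, map_smul] at h1 h2
  rw [← eq_sub_iff_add_eq] at h1 h2
  rw [h1, h2, yosida, smul_apply, add_apply, smul_sub,
    smul_sub, smul_smul, smul_smul]
  have e1 : Complex.I * c * (Complex.I * c) = -(c ^ 2 : ℝ) := by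
    push_cast; linear_combination (c : ℂ) ^ 2 * Complex.I_mul_I
  have e2 : Complex.I * (-c : ℝ) * (Complex.I * (-c : ℝ)) = -(c ^ 2 : ℝ) := by
    push_cast; linear_combination (c : ℂ) ^ 2 * Complex.I_mul_I
  rw [e1, e2]
  simp only [← Complex.coe_smul]
  push_cast
  module

theorem tendsto_yosida (hH : IsSelfAdjoint H) (x : H.domain) :
    Tendsto (fun n : ℕ => yosida H (n + 1) (x : 𝓗)) atTop (𝓝 (H x)) := by
  have hc : ∀ n : ℕ, ((n : ℝ) + 1) ≠ 0 := fun n => by positivity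
  have hlim : Tendsto (fun n : ℕ => |(n : ℝ) + 1|) atTop atTop :=
    tendsto_abs_atTop_atTop.comp (tendsto_atTop_add_const_right _ _ tendsto_natCast_atTop_atTop)
  have h1 := hH.tendsto_smul_resolventI hc hlim (H x)
  have h2 := hH.tendsto_smul_resolventI (c := fun n : ℕ => -((n : ℝ) + 1))
    (fun n => neg_ne_zero.2 (hc n)) (by simpa only [abs_neg] using hlim) (H x)
  have h3 := (h1.add h2).const_smul (1 / 2 : ℝ)
  have e : (1 / 2 : ℝ) • (H x + H x) = H x := by
    rw [← two_smul ℝ, smul_smul]; norm_num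
  rw [e] at h3
  exact h3.congr fun n => (hH.yosida_apply (hc n) x).symm

/-- **Stone's theorem**: a self-adjoint operator generates a unitary group. -/
theorem exists_isUnitaryGroupOf (hH : IsSelfAdjoint H) {hbar : ℝ} (hhbar : 0 < hbar) :
    ∃ U, IsUnitaryGroupOf H hbar U := by
  let z : ℂ := -(Complex.I / hbar)
  have hz : star z = -z := by simp [z, neg_div]
  have hz0 : z ≠ 0 := neg_ne_zero.2 (div_ne_zero Complex.I_ne_zero (by exact_mod_cast hhbar.ne'))
  have hc : ∀ n : ℕ, ((n : ℝ) + 1) ≠ 0 := fun n => by positivity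
  let L : 𝓗 → 𝓗 := by classical exact fun v => if hv : v ∈ H.domain then z • H ⟨v, hv⟩ else 0
  have hLx : ∀ x : H.domain, L x = z • H x := fun x => by simp [L]
  obtain ⟨U, hU, hU0, hUadd, hUc, hUd⟩ := exists_unitary_group_of_tendsto
    (B := fun n : ℕ => z • yosida H (n + 1))
    (fun n => by
      rw [skewAdjoint.mem_iff, star_smul, hz, hH.star_yosida (hc n), neg_smul])
    (fun m n => ((hH.commute_yosida (hc m) (hc n)).smul_left z).smul_right z)
    hH.dense_domain (L := L)
    (fun v hv => by
      have h := (hH.tendsto_yosida ⟨v, hv⟩).const_smul z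
      rw [← hLx] at h
      exact h)
  refine ⟨U, hU, hU0, hUadd, hUc, fun ψ => ⟨fun hψ => (hUd ψ hψ).differentiableAt, fun hψ => ?_⟩,
    fun ψ => by rw [← hLx]; exact hUd ψ ψ.2⟩
  -- The generator is no larger than `H`: differentiating the constant `⟨U(t)ψ, U(t)y⟩` at `0` puts
  -- `ψ` in the domain of `H* = H`.
  have hg : (ψ, z⁻¹ • deriv (fun t => U t ψ) 0) ∈ H.graph := by
    refine hH.mem_graph_of_forall_inner fun y => ?_
    have h1 : HasDerivAt (fun t => inner ℂ (U t ψ) (U t y))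
        (inner ℂ (U 0 ψ) (L y) + inner ℂ (deriv (fun t => U t ψ) 0) (U 0 y)) 0 :=
      hψ.hasDerivAt.inner ℂ (hUd y y.2)
    have h2 : (fun t => inner ℂ (U t ψ) (U t y)) = fun _ => (inner ℂ ψ (y : 𝓗) : ℂ) := by
      funext t
      rw [← ContinuousLinearMap.adjoint_inner_right, ← ContinuousLinearMap.star_eq_adjoint,
        ← mul_apply_eq_comp, Unitary.star_mul_self_of_mem (hU t), one_apply_eq_self]
    rw [h2] at h1
    have h3 := h1.unique (hasDerivAt_const 0 _)
    rw [hU0, one_apply_eq_self, one_apply_eq_self, hLx, inner_smul_right] at h3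
    have hzc : (starRingEnd ℂ) z⁻¹ = -z⁻¹ := by
      rw [map_inv₀]; change (star z)⁻¹ = _; rw [hz, inv_neg]
    rw [inner_smul_left, hzc]
    field_simp
    linear_combination -h3
  exact LinearPMap.mem_domain_of_mem_graph hg

end IsSelfAdjoint

theorem IsSelfAdjoint.isUnitaryGroupOf_propagator (hH : IsSelfAdjoint H) {hbar : ℝ}
    (hhbar : 0 < hbar) : IsUnitaryGroupOf H hbar (propagator H hbar) := by
  have h := hH.exists_isUnitaryGroupOf hhbar
  rw [propagator, dif_pos h]
  exact h.choose_spec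

end Resolvent

/-! ### The free evolution -/

namespace IsUnitaryGroupOf

variable {𝓗 : Type*} [NormedAddCommGroup 𝓗] [InnerProductSpace ℂ 𝓗] [CompleteSpace 𝓗]
  {H : 𝓗 →ₗ.[ℂ] 𝓗} {hbar : ℝ} {U : ℝ → 𝓗 →L[ℂ] 𝓗}

theorem apply_apply (hU : IsUnitaryGroupOf H hbar U) (s t : ℝ) (v : 𝓗) :
    U s (U t v) = U (s + t) v := by
  rw [hU.add, mul_apply_eq_comp]

theorem zero_apply (hU : IsUnitaryGroupOf H hbar U) (v : 𝓗) : U 0 v = v := by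
  rw [hU.zero, one_apply_eq_self]

theorem adjoint_eq (hU : IsUnitaryGroupOf H hbar U) (t : ℝ) :
    ContinuousLinearMap.adjoint (U t) = U (-t) := by
  have h1 : star (U t) * U t = 1 := Unitary.star_mul_self_of_mem (hU.unitary t)
  have h2 : U t * U (-t) = 1 := by rw [← hU.add, add_neg_cancel, hU.zero]
  rw [← ContinuousLinearMap.star_eq_adjoint, ← mul_one (star (U t)), ← h2, ← mul_assoc, h1,
    one_mul]

theorem apply_eq_of_hasDerivAt (hU : IsUnitaryGroupOf H hbar U) {w v : 𝓗} (h : w ∈ H.domain)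
    (hd : HasDerivAt (fun t => U t w) v 0) : (Complex.I / (hbar : ℂ)) • H ⟨w, h⟩ = -v := by
  rw [hd.unique (hU.hasDerivAt ⟨w, h⟩), neg_smul, neg_neg]

/-- `∫ₐᵇ U(s)φ ds` is in the domain of `H`, and `(i/ħ) H` maps it to `U(a)φ - U(b)φ`. -/
theorem exists_mem_domain_integral (hU : IsUnitaryGroupOf H hbar U) (φ : 𝓗) (a b : ℝ) :
    ∃ hw : (∫ s in a..b, U s φ) ∈ H.domain,
      (Complex.I / (hbar : ℂ)) • H ⟨∫ s in a..b, U s φ, hw⟩ = U a φ - U b φ := by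
  have hc := hU.continuous φ
  have hd : ∀ x, HasDerivAt (fun t => ∫ s in (0 : ℝ)..t, U s φ) (U x φ) x := fun x =>
    intervalIntegral.integral_hasDerivAt_right (hc.intervalIntegrable _ _)
      (hc.stronglyMeasurableAtFilter _ _) hc.continuousAt
  -- `U(t)` translates the interval of integration, so the orbit of the integral is a difference of
  -- primitives and is differentiable, although `φ` need not be in the domain of `H`.
  have h1 : (fun t => U t (∫ s in a..b, U s φ)) =
      fun t => (∫ s in (0 : ℝ)..(b + t), U s φ) - ∫ s in (0 : ℝ)..(a + t), U s φ := by
    funext t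
    rw [intervalIntegral.integral_interval_sub_left (hc.intervalIntegrable _ _)
      (hc.intervalIntegrable _ _), ← intervalIntegral.integral_comp_add_right fun s => U s φ,
      ← ContinuousLinearMap.intervalIntegral_comp_comm (U t) (hc.intervalIntegrable _ _)]
    exact intervalIntegral.integral_congr fun s _ => by
      simp only [hU.apply_apply, add_comm]
  have h2 : HasDerivAt (fun t => U t (∫ s in a..b, U s φ)) (U b φ - U a φ) 0 := by
    rw [h1]
    have hb := (hd (b + 0)).comp_const_add b 0
    have ha := (hd (a + 0)).comp_const_add a 0
    simp only [add_zero] at ha hb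
    exact hb.sub ha
  have hw := (hU.mem_domain_iff _).2 h2.differentiableAt
  exact ⟨hw, by rw [hU.apply_eq_of_hasDerivAt hw h2, neg_sub]⟩

/-- `U(t)U(s)x = U(s)U(t)x`; differentiate at `t = 0`. -/
theorem mem_graph_apply (hU : IsUnitaryGroupOf H hbar U) (hhbar : hbar ≠ 0) {p : 𝓗 × 𝓗}
    (hp : p ∈ H.graph) (s : ℝ) : (U s p.1, U s p.2) ∈ H.graph := by
  obtain ⟨x, hx1, hx2⟩ := (LinearPMap.mem_graph_iff _).1 hp
  have h1 : HasDerivAt (fun t => U t (U s x)) (U s (-(Complex.I / (hbar : ℂ)) • H x)) 0 := by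
    have h := ((U s).restrictScalars ℝ).hasFDerivAt.comp_hasDerivAt 0 (hU.hasDerivAt x)
    refine h.congr_of_eventuallyEq (Eventually.of_forall fun t => ?_)
    simp [hU.apply_apply, add_comm]
  have hw := (hU.mem_domain_iff _).2 h1.differentiableAt
  have h2 := hU.apply_eq_of_hasDerivAt hw h1
  rw [map_smul, neg_smul, neg_neg] at h2
  have h3 : Complex.I / (hbar : ℂ) ≠ 0 :=
    div_ne_zero Complex.I_ne_zero (by exact_mod_cast hhbar)
  rw [← hx1, ← hx2, LinearPMap.mem_graph_iff]
  exact ⟨⟨_, hw⟩, rfl, smul_right_injective _ h3 h2⟩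

theorem smul_integral_eq (hU : IsUnitaryGroupOf H hbar U) {p : 𝓗 × 𝓗}
    (hp : p ∈ H.graph) (a b : ℝ) :
    (Complex.I / (hbar : ℂ)) • (∫ s in a..b, U s p.2) = U a p.1 - U b p.1 := by
  obtain ⟨x, hx1, hx2⟩ := (LinearPMap.mem_graph_iff _).1 hp
  have hd : ∀ s, HasDerivAt (fun t => U t p.1) (-(Complex.I / (hbar : ℂ)) • U s p.2) s :=
    fun s => by
      have h0 := hU.hasDerivAt x
      rw [← sub_self s] at h0
      have h := ((U s).restrictScalars ℝ).hasFDerivAt.comp_hasDerivAt s (h0.comp_sub_const s s)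
      rw [← hx1, ← hx2, ← map_smul]
      refine h.congr_of_eventuallyEq (Eventually.of_forall fun t => ?_)
      simp [hU.apply_apply]
  have hc : Continuous fun s => -(Complex.I / (hbar : ℂ)) • U s p.2 :=
    (hU.continuous p.2).const_smul _
  have h := intervalIntegral.integral_eq_sub_of_hasDerivAt (fun s _ => hd s)
    (hc.intervalIntegrable a b)
  rw [intervalIntegral.integral_smul, neg_smul] at h
  rw [← neg_sub (U b p.1), ← h, neg_neg]

end IsUnitaryGroupOf

/-! ### Functional calculus of a spectral measure -/

namespace SpectralMeasure

open scoped ENNReal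

variable {X : Type*} [MeasurableSpace X] {𝓗 : Type*}
  [NormedAddCommGroup 𝓗] [InnerProductSpace ℂ 𝓗] [CompleteSpace 𝓗] (E : SpectralMeasure X 𝓗)

theorem measure_apply (ψ : 𝓗) {A : Set X} (hA : MeasurableSet A) :
    E.measure ψ A = ‖E.proj A ψ‖ₑ ^ 2 := by
  rw [measure, Measure.ofMeasurable_apply A hA, ENNReal.ofReal_pow (norm_nonneg _),
    ofReal_norm]

theorem measure_univ (ψ : 𝓗) : E.measure ψ univ = ‖ψ‖ₑ ^ 2 := by
  rw [E.measure_apply ψ MeasurableSet.univ, E.proj_univ, one_apply_eq_self]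

instance isFiniteMeasure_measure (ψ : 𝓗) : IsFiniteMeasure (E.measure ψ) :=
  ⟨by rw [measure_univ]; exact ENNReal.pow_lt_top enorm_lt_top⟩

theorem proj_union {A B : Set X} (hA : MeasurableSet A) (hB : MeasurableSet B)
    (hAB : Disjoint A B) : E.proj (A ∪ B) = E.proj A + E.proj B := by
  ext ψ
  -- Countable additivity is all that is assumed; the pair is padded with empty sets.
  let S : ℕ → Set X := fun n => if n = 0 then A else if n = 1 then B else ∅
  have hS : (⋃ n, S n) = A ∪ B := by
    ext x
    simp only [mem_iUnion, mem_union]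
    constructor
    · rintro ⟨n, hn⟩
      by_cases h0 : n = 0
      · exact Or.inl (by simpa [S, h0] using hn)
      · by_cases h1 : n = 1
        · exact Or.inr (by simpa [S, h1] using hn)
        · simp [S, h0, h1] at hn
    · rintro (h | h)
      · exact ⟨0, by simpa [S] using h⟩
      · exact ⟨1, by simpa [S] using h⟩
  have h := E.hasSum_iUnion S (fun n => by
      simp only [S]; split_ifs
      exacts [hA, hB, MeasurableSet.empty])
    (fun m n hmn => by
      simp only [S]
      split_ifs with h1 h2 h3 h4 h5
      · omega
      · exact hAB
      · simp
      · exact hAB.symm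
      · omega
      all_goals simp) ψ
  have h2 : HasSum (fun n => E.proj (S n) ψ) (∑ n ∈ Finset.range 2, E.proj (S n) ψ) :=
    hasSum_sum_of_ne_finset_zero fun n hn => by
      have : 1 < n := by simpa using hn
      have h0 : n ≠ 0 := by omega
      have h1 : n ≠ 1 := by omega
      simp [S, h0, h1, E.proj_empty]
  rw [hS] at h
  rw [h.unique h2]
  simp [Finset.sum_range_succ, S]

theorem proj_compl {A : Set X} (hA : MeasurableSet A) : E.proj Aᶜ = 1 - E.proj A := by
  rw [eq_sub_iff_add_eq', ← E.proj_union hA hA.compl disjoint_compl_right, union_compl_self,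
    E.proj_univ]

theorem inner_proj_proj_of_disjoint {A B : Set X} (hA : MeasurableSet A) (hB : MeasurableSet B)
    (hAB : Disjoint A B) (φ ψ : 𝓗) : inner ℂ (E.proj A φ) (E.proj B ψ) = 0 := by
  have h : ContinuousLinearMap.adjoint (E.proj A) = E.proj A :=
    (E.isStarProjection A hA).isSelfAdjoint
  rw [← ContinuousLinearMap.adjoint_inner_right, h, ← mul_apply_eq_comp, ← E.proj_inter A B hA hB,
    hAB.inter_eq, E.proj_empty]
  simp

theorem ae_of_proj_eq_zero {p : X → Prop} (hp : MeasurableSet {x | ¬ p x})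
    (h : E.proj {x | ¬ p x} = 0) (ψ : 𝓗) : ∀ᵐ x ∂E.measure ψ, p x := by
  rw [ae_iff, E.measure_apply ψ hp, h]
  simp

/-- Parallelogram law. Square integrability for `φ` and `ψ` thereby passes to `φ - ψ`. -/
theorem measure_sub_le (φ ψ : 𝓗) :
    E.measure (φ - ψ) ≤ (2 : ℝ≥0∞) • (E.measure φ + E.measure ψ) := by
  refine Measure.le_iff.2 fun A hA => ?_
  simp only [Measure.smul_apply, Measure.add_apply, E.measure_apply _ hA, smul_eq_mul, map_sub]
  generalize E.proj A φ = a
  generalize E.proj A ψ = b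
  simp only [← ofReal_norm]
  rw [← ENNReal.ofReal_pow (norm_nonneg _), ← ENNReal.ofReal_pow (norm_nonneg _),
    ← ENNReal.ofReal_pow (norm_nonneg _), ← ENNReal.ofReal_add (by positivity) (by positivity),
    ← ENNReal.ofReal_ofNat 2, ← ENNReal.ofReal_mul (by norm_num)]
  refine ENNReal.ofReal_le_ofReal ?_
  have h := parallelogram_law_with_norm ℂ a b
  nlinarith [mul_self_nonneg ‖a + b‖]

/-! #### Simple functions -/

/-- The vector measure `A ↦ E(A)ψ`, as a family of operators `c ↦ c • E(A)ψ`. -/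
def smulRight (ψ : 𝓗) (A : Set X) : ℂ →L[ℝ] 𝓗 :=
  (ContinuousLinearMap.toSpanSingleton ℂ (E.proj A ψ)).restrictScalars ℝ

/-- Additivity in the simple function then comes from the general theory of finitely additive set
functions. -/
theorem simpleIntegral_eq_setToSimpleFunc (g : SimpleFunc X ℂ) (ψ : 𝓗) :
    E.simpleIntegral g ψ = SimpleFunc.setToSimpleFunc (E.smulRight ψ) g := by
  simp [simpleIntegral, SimpleFunc.setToSimpleFunc, smulRight]

theorem finMeasAdditive_smulRight (ψ : 𝓗) : FinMeasAdditive (E.measure ψ) (E.smulRight ψ) :=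
  fun A B hA hB _ _ hAB => by
    ext
    simp [smulRight, E.proj_union hA hB hAB]

theorem simpleIntegral_sub (f g : SimpleFunc X ℂ) (ψ : 𝓗) :
    E.simpleIntegral (f - g) ψ = E.simpleIntegral f ψ - E.simpleIntegral g ψ := by
  simp only [simpleIntegral_eq_setToSimpleFunc]
  exact SimpleFunc.setToSimpleFunc_sub _ (E.finMeasAdditive_smulRight ψ)
    (SimpleFunc.integrable_of_isFiniteMeasure f) (SimpleFunc.integrable_of_isFiniteMeasure g)

theorem simpleIntegral_sub_vector (g : SimpleFunc X ℂ) (φ ψ : 𝓗) :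
    E.simpleIntegral g (φ - ψ) = E.simpleIntegral g φ - E.simpleIntegral g ψ := by
  simp [simpleIntegral, smul_sub]

theorem simpleIntegral_const [Nonempty X] (c : ℂ) (ψ : 𝓗) :
    E.simpleIntegral (SimpleFunc.const X c) ψ = c • ψ := by
  rw [simpleIntegral, SimpleFunc.range_const, Finset.sum_singleton]
  have h : (SimpleFunc.const X c ⁻¹' {c} : Set X) = univ := by ext; simp
  rw [h, E.proj_univ, one_apply_eq_self]

theorem simpleIntegral_eq_sum_of_subset (g : SimpleFunc X ℂ) {s : Finset ℂ} (hs : g.range ⊆ s)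
    (ψ : 𝓗) : E.simpleIntegral g ψ = ∑ c ∈ s, c • E.proj (g ⁻¹' {c}) ψ := by
  refine Finset.sum_subset hs fun c _ hc => ?_
  have h : (g ⁻¹' {c} : Set X) = ∅ := by
    rw [SimpleFunc.mem_range] at hc
    exact preimage_singleton_eq_empty.2 hc
  simp [h, E.proj_empty]

theorem norm_sq_simpleIntegral (g : SimpleFunc X ℂ) (ψ : 𝓗) :
    ‖E.simpleIntegral g ψ‖ ^ 2 = ∑ c ∈ g.range, ‖c‖ ^ 2 * ‖E.proj (g ⁻¹' {c}) ψ‖ ^ 2 := by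
  have h : (inner ℂ (E.simpleIntegral g ψ) (E.simpleIntegral g ψ) : ℂ) =
      ∑ c ∈ g.range, inner ℂ (c • E.proj (g ⁻¹' {c}) ψ) (c • E.proj (g ⁻¹' {c}) ψ) := by
    conv_lhs => rw [simpleIntegral, sum_inner]
    refine Finset.sum_congr rfl fun c hc => ?_
    rw [inner_sum]
    refine Finset.sum_eq_single_of_mem c hc fun b _ hb => ?_
    rw [inner_smul_left, inner_smul_right,
      E.inner_proj_proj_of_disjoint (g.measurableSet_fiber c) (g.measurableSet_fiber b)
        ((disjoint_singleton.2 hb.symm).preimage g)]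
    simp
  simp only [inner_self_eq_norm_sq_to_K, norm_smul] at h
  simp only [← mul_pow]
  exact_mod_cast h

theorem eLpNorm_two_sq {Y F : Type*} [MeasurableSpace Y] [NormedAddCommGroup F] (f : Y → F)
    (μ : Measure Y) : eLpNorm f 2 μ ^ 2 = ∫⁻ x, ‖f x‖ₑ ^ 2 ∂μ := by
  have h := eLpNorm_nnreal_pow_eq_lintegral (f := f) (μ := μ) (p := 2) (by norm_num)
  simpa using h

/-- Fibres of `g` are disjoint, so their projections are orthogonal and Pythagoras applies. This
isometry is the basis of the functional calculus. -/
theorem enorm_simpleIntegral (g : SimpleFunc X ℂ) (ψ : 𝓗) :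
    ‖E.simpleIntegral g ψ‖ₑ = eLpNorm g 2 (E.measure ψ) := by
  have h : ‖E.simpleIntegral g ψ‖ₑ ^ 2 = eLpNorm g 2 (E.measure ψ) ^ 2 := by
    have h1 : (fun x => ‖g x‖ₑ ^ 2) = ⇑(g.map fun c => ‖c‖ₑ ^ 2) := rfl
    rw [eLpNorm_two_sq, h1, SimpleFunc.lintegral_eq_lintegral, SimpleFunc.map_lintegral,
      ← ofReal_norm, ← ENNReal.ofReal_pow (norm_nonneg _), norm_sq_simpleIntegral,
      ENNReal.ofReal_sum_of_nonneg fun c _ => by positivity]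
    refine Finset.sum_congr rfl fun c _ => ?_
    rw [E.measure_apply ψ (g.measurableSet_fiber c), ENNReal.ofReal_mul (by positivity),
      ENNReal.ofReal_pow (norm_nonneg _), ENNReal.ofReal_pow (norm_nonneg _),
      ofReal_norm, ofReal_norm]
  exact (ENNReal.pow_right_strictMono two_ne_zero).injective h

/-! #### Square integrable functions -/

/-- The `limUnder` in the definition is a genuine limit: density of simple functions makes the
filter nontrivial, and the isometry with completeness makes the values converge. -/
theorem tendsto_integral {f : X → ℂ} {ψ : 𝓗} (hf : ψ ∈ E.dom f) :
    Tendsto (fun g => E.simpleIntegral g ψ)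
      (comap (fun g : SimpleFunc X ℂ => eLpNorm (fun x => f x - g x) 2 (E.measure ψ)) (𝓝 0))
      (𝓝 (E.integral f ψ)) := by
  have hf : MemLp f 2 (E.measure ψ) := hf
  set l := comap (fun g : SimpleFunc X ℂ => eLpNorm (fun x => f x - g x) 2 (E.measure ψ)) (𝓝 0)
  have hne : l.NeBot := by
    rw [comap_neBot_iff]
    intro t ht
    obtain ⟨ε, hε, hεt⟩ := ENNReal.nhds_zero_basis.mem_iff.1 ht
    obtain ⟨g, hg, _⟩ := hf.exists_simpleFunc_eLpNorm_sub_lt (by simp) hε.ne'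
    exact ⟨g, hεt hg⟩
  have hcau : Cauchy (map (fun g => E.simpleIntegral g ψ) l) := by
    rw [EMetric.cauchy_iff]
    refine ⟨(hne.map _).ne, fun ε hε => ?_⟩
    have hε2 : 0 < ε / 2 := ENNReal.half_pos hε.ne'
    refine ⟨_, image_mem_map (preimage_mem_comap (Iio_mem_nhds hε2)), ?_⟩
    rintro _ ⟨g, hg, rfl⟩ _ ⟨h, hh, rfl⟩
    simp only [mem_preimage, mem_Iio] at hg hh
    rw [edist_eq_enorm_sub, ← simpleIntegral_sub, enorm_simpleIntegral]
    have e : ⇑(g - h) = (fun x => f x - h x) - fun x => f x - g x := by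
      ext x; simp
    rw [e]
    refine (eLpNorm_sub_le (hf.1.sub h.aestronglyMeasurable) (hf.1.sub g.aestronglyMeasurable)
      (by norm_num)).trans_lt ?_
    rw [← ENNReal.add_halves ε]
    exact ENNReal.add_lt_add hh hg
  exact hcau.le_nhds_lim

theorem tendsto_integral_of_tendsto {ι : Type*} {l : Filter ι} {f : X → ℂ} {ψ : 𝓗}
    (hf : ψ ∈ E.dom f) {g : ι → SimpleFunc X ℂ}
    (hg : Tendsto (fun n => eLpNorm (fun x => f x - g n x) 2 (E.measure ψ)) l (𝓝 0)) :
    Tendsto (fun n => E.simpleIntegral (g n) ψ) l (𝓝 (E.integral f ψ)) :=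
  (E.tendsto_integral hf).comp (tendsto_comap_iff.2 hg)

theorem exists_seq_simpleFunc_tendsto {f : X → ℂ} {μ : Measure X} (hf : MemLp f 2 μ) :
    ∃ g : ℕ → SimpleFunc X ℂ, Tendsto (fun n => eLpNorm (fun x => f x - g n x) 2 μ) atTop (𝓝 0) := by
  choose g hg _ using fun n : ℕ => hf.exists_simpleFunc_eLpNorm_sub_lt (by simp)
    (ENNReal.inv_ne_zero.2 (ENNReal.natCast_ne_top n))
  exact ⟨g, tendsto_of_tendsto_of_tendsto_of_le_of_le tendsto_const_nhds
    ENNReal.tendsto_inv_nat_nhds_zero (fun _ => zero_le) fun n => (hg n).le⟩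

theorem enorm_integral_le {f : X → ℂ} {ψ : 𝓗} (hf : ψ ∈ E.dom f) :
    ‖E.integral f ψ‖ₑ ≤ eLpNorm f 2 (E.measure ψ) := by
  obtain ⟨g, hg⟩ := exists_seq_simpleFunc_tendsto hf
  have h1 := (E.tendsto_integral_of_tendsto hf hg).enorm
  have h2 := (tendsto_const_nhds (x := eLpNorm f 2 (E.measure ψ))).add hg
  rw [add_zero] at h2
  refine le_of_tendsto_of_tendsto' h1 h2 fun n => ?_
  rw [enorm_simpleIntegral]
  have e : ⇑(g n) = f - fun x => f x - g n x := by ext x; simp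
  conv_lhs => rw [e]
  exact eLpNorm_sub_le (MemLp.aestronglyMeasurable hf)
    ((MemLp.aestronglyMeasurable hf).sub (g n).aestronglyMeasurable) (by norm_num)

theorem integral_congr_ae {f f' : X → ℂ} {ψ : 𝓗} (h : f =ᵐ[E.measure ψ] f') :
    E.integral f ψ = E.integral f' ψ := by
  have e : (fun g : SimpleFunc X ℂ => eLpNorm (fun x => f x - g x) 2 (E.measure ψ)) =
      fun g : SimpleFunc X ℂ => eLpNorm (fun x => f' x - g x) 2 (E.measure ψ) :=
    funext fun g => eLpNorm_congr_ae (h.sub EventuallyEq.rfl)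
  rw [integral, integral, e]

theorem mem_dom_congr_ae {f f' : X → ℂ} {ψ : 𝓗} (h : f =ᵐ[E.measure ψ] f') :
    ψ ∈ E.dom f ↔ ψ ∈ E.dom f' :=
  memLp_congr_ae h

theorem mem_dom_const (c : ℂ) (ψ : 𝓗) : ψ ∈ E.dom fun _ => c :=
  memLp_const c

theorem integral_const [Nonempty X] (c : ℂ) (ψ : 𝓗) : E.integral (fun _ => c) ψ = c • ψ := by
  have h := E.tendsto_integral_of_tendsto (E.mem_dom_const c ψ) (l := (atTop : Filter ℕ))
    (g := fun _ => SimpleFunc.const X c) (by simp)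
  simp only [simpleIntegral_const] at h
  exact tendsto_nhds_unique h tendsto_const_nhds

/-- One sequence of simple functions, approximating `f` for the sum of the measures of `φ` and `ψ`,
serves all three vectors at once. -/
theorem integral_sub_vector {f : X → ℂ} {φ ψ : 𝓗} (hφ : φ ∈ E.dom f) (hψ : ψ ∈ E.dom f) :
    φ - ψ ∈ E.dom f ∧ E.integral f (φ - ψ) = E.integral f φ - E.integral f ψ := by
  have hle : ∀ g : X → ℂ, eLpNorm g 2 (E.measure (φ - ψ)) ≤
      (2 : ℝ≥0∞) ^ (1 / (2 : ℝ≥0∞)).toReal • eLpNorm g 2 (E.measure φ + E.measure ψ) := fun g => by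
    rw [← eLpNorm_smul_measure_of_ne_top (by simp)]
    exact eLpNorm_mono_measure g (E.measure_sub_le φ ψ)
  have hsum : MemLp f 2 (E.measure φ + E.measure ψ) := by
    have hφ : MemLp f 2 (E.measure φ) := hφ
    have hψ : MemLp f 2 (E.measure ψ) := hψ
    refine ⟨hφ.1.add_measure hψ.1, ?_⟩
    have h : eLpNorm f 2 (E.measure φ + E.measure ψ) ^ 2 < ∞ := by
      rw [eLpNorm_two_sq, lintegral_add_measure, ← eLpNorm_two_sq, ← eLpNorm_two_sq]
      exact ENNReal.add_lt_top.2 ⟨ENNReal.pow_lt_top hφ.2, ENNReal.pow_lt_top hψ.2⟩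
    exact (ENNReal.pow_lt_top_iff.1 h).resolve_right two_ne_zero
  have hdom : φ - ψ ∈ E.dom f :=
    (hsum.smul_measure (c := 2) (by simp)).mono_measure (E.measure_sub_le φ ψ)
  obtain ⟨g, hg⟩ := exists_seq_simpleFunc_tendsto hsum
  have h0 : Tendsto (fun _ : ℕ => (0 : ℝ≥0∞)) atTop (𝓝 0) := tendsto_const_nhds
  have h1 := E.tendsto_integral_of_tendsto hφ (tendsto_of_tendsto_of_tendsto_of_le_of_le h0 hg
    (fun _ => zero_le) fun n => eLpNorm_mono_measure _ (Measure.le_add_right le_rfl))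
  have h2 := E.tendsto_integral_of_tendsto hψ (tendsto_of_tendsto_of_tendsto_of_le_of_le h0 hg
    (fun _ => zero_le) fun n => eLpNorm_mono_measure _ (Measure.le_add_left le_rfl))
  have h3 := E.tendsto_integral_of_tendsto hdom (g := g) (l := atTop) (by
    have h4 := ENNReal.Tendsto.const_mul hg
      (Or.inr (show (2 : ℝ≥0∞) ^ (1 / (2 : ℝ≥0∞)).toReal ≠ ∞ by simp))
    rw [mul_zero] at h4
    exact tendsto_of_tendsto_of_tendsto_of_le_of_le h0 h4 (fun _ => zero_le)
      fun n => hle _)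
  refine ⟨hdom, tendsto_nhds_unique h3 ?_⟩
  simpa only [simpleIntegral_sub_vector] using h1.sub h2

/-! #### Measurable dependence on a parameter -/

variable {Y : Type*} [MeasurableSpace Y]

/-- A π-λ argument starting from rectangles, where the section is either `B` or empty. -/
theorem stronglyMeasurable_proj_section {S : Set (Y × X)} (hS : MeasurableSet S) (ψ : 𝓗) :
    StronglyMeasurable fun y => E.proj (Prod.mk y ⁻¹' S) ψ := by
  induction S, hS using MeasurableSpace.induction_on_inter generateFrom_prod.symm
    isPiSystem_prod with
  | empty => simpa [E.proj_empty] using stronglyMeasurable_const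
  | basic S hS =>
    obtain ⟨A, hA, B, hB, rfl⟩ := hS
    have e : (fun y => E.proj (Prod.mk y ⁻¹' (A ×ˢ B)) ψ) = A.indicator fun _ => E.proj B ψ := by
      classical
      funext y
      by_cases hy : y ∈ A
      · rw [mk_preimage_prod_right hy, indicator_of_mem hy]
      · rw [mk_preimage_prod_right_eq_empty hy, indicator_of_notMem hy, E.proj_empty, zero_apply]
    rw [e]
    exact stronglyMeasurable_const.indicator hA
  | compl S hS ih =>
    simp only [preimage_compl, E.proj_compl (measurable_prodMk_left hS), sub_apply,
      one_apply_eq_self]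
    exact stronglyMeasurable_const.sub ih
  | iUnion S hd hS ih =>
    simp only [preimage_iUnion]
    refine stronglyMeasurable_of_tendsto atTop
      (f := fun n y => ∑ i ∈ Finset.range n, E.proj (Prod.mk y ⁻¹' S i) ψ)
      (fun n => Finset.stronglyMeasurable_fun_sum _ fun i _ => ih i)
      (tendsto_pi_nhds.2 fun y => ?_)
    exact (E.hasSum_iUnion _ (fun n => measurable_prodMk_left (hS n))
      (fun m n hmn => (hd hmn).preimage _) ψ).tendsto_sum_nat

theorem aestronglyMeasurable_integral {F : Y × X → ℂ} (hF : Measurable F) {μ : Measure Y} {ψ : 𝓗}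
    (hdom : ∀ᵐ y ∂μ, ψ ∈ E.dom fun x => F (y, x)) :
    AEStronglyMeasurable (fun y => E.integral (fun x => F (y, x)) ψ) μ := by
  -- Approximating jointly on the product gives sections whose integrals are measurable in `y`; for
  -- each admissible `y` the same sequence converges in `L²`.
  let F' : ℕ → SimpleFunc (Y × X) ℂ := SimpleFunc.approxOn F hF univ 0 (mem_univ _)
  have hsec : ∀ n, StronglyMeasurable fun y =>
      E.simpleIntegral ((F' n).comp (Prod.mk y) measurable_prodMk_left) ψ := fun n => by
    have e : ∀ y, E.simpleIntegral ((F' n).comp (Prod.mk y) measurable_prodMk_left) ψ =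
        ∑ c ∈ (F' n).range, c • E.proj (Prod.mk y ⁻¹' (F' n ⁻¹' {c})) ψ := fun y =>
      E.simpleIntegral_eq_sum_of_subset _ (SimpleFunc.range_comp_subset_range _ _) ψ
    simp only [e]
    exact Finset.stronglyMeasurable_fun_sum _ fun c _ =>
      (E.stronglyMeasurable_proj_section ((F' n).measurableSet_fiber c) ψ).const_smul c
  refine aestronglyMeasurable_of_tendsto_ae atTop
    (fun n => (hsec n).aestronglyMeasurable) ?_
  filter_upwards [hdom] with y hy
  refine E.tendsto_integral_of_tendsto hy ?_
  have h := SimpleFunc.tendsto_approxOn_Lp_eLpNorm (p := 2) (μ := E.measure ψ)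
    (hF.comp (measurable_prodMk_left (x := y))) (mem_univ (0 : ℂ)) (by simp) (by simp)
    (by simpa using (show MemLp (fun x => F (y, x)) 2 (E.measure ψ) from hy).2)
  refine h.congr fun n => ?_
  rw [← eLpNorm_neg, neg_sub]
  rfl

end SpectralMeasure

/-! ### The pointer measure and the reduction operators -/

namespace PointerScale

variable {d : ℕ}

theorem countable_points_lattice (ε : ℝ) (hε : 0 < ε) :
    ((lattice ε hε).points d).Countable := by
  refine (countable_range fun n : Fin d → ℤ => (WithLp.toLp 2 fun α => ε * n α : Coord d)).mono ?_
  intro y hy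
  choose n hn using hy
  exact ⟨n, by ext α; exact (hn α).symm⟩

theorem measurableSet_points (Λ : PointerScale) : MeasurableSet (Λ.points d) := by
  cases Λ with
  | continuum => exact MeasurableSet.univ
  | lattice ε hε => exact (countable_points_lattice ε hε).measurableSet

theorem sub_mem_points_iff (Λ : PointerScale) {y z : Coord d} (hz : z ∈ Λ.points d) :
    y - z ∈ Λ.points d ↔ y ∈ Λ.points d := by
  cases Λ with
  | continuum => simp [points]
  | lattice ε hε =>
    refine forall_congr' fun α => ?_
    obtain ⟨m, hm⟩ := hz α
    rw [PiLp.sub_apply, hm]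
    constructor
    · rintro ⟨n, hn⟩
      exact ⟨n + m, by push_cast; linarith⟩
    · rintro ⟨n, hn⟩
      exact ⟨n - m, by push_cast; linarith⟩

/-- Needed for Tonelli. The counting measure becomes a countable sum of point masses only after
restriction to the lattice. -/
instance sFinite_volumeMeasure (Λ : PointerScale) : SFinite (Λ.volumeMeasure d) := by
  cases Λ with
  | continuum => unfold volumeMeasure; infer_instance
  | lattice ε hε =>
    have hc : Countable ((lattice ε hε).points d) := countable_points_lattice ε hε
    have h : (Measure.count : Measure (Coord d)).restrict ((lattice ε hε).points d) =
        Measure.sum fun y : (lattice ε hε).points d => Measure.count.restrict {(y : Coord d)} := by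
      rw [← Measure.restrict_iUnion _ fun _ => measurableSet_singleton _]
      · congr 1
        ext; simp
      · intro x y hxy
        exact disjoint_singleton.2 fun h => hxy (Subtype.ext h)
    have hf : ∀ y : (lattice ε hε).points d,
        IsFiniteMeasure ((Measure.count : Measure (Coord d)).restrict {(y : Coord d)}) := fun y =>
      isFiniteMeasure_restrict.2 (by simp)
    change SFinite (ENNReal.ofReal (ε ^ d) • Measure.count.restrict ((lattice ε hε).points d))
    rw [h]
    infer_instance

/-- Lebesgue and counting measure are translation invariant, and a translation by a point of `Λ`
maps `Λ` onto itself. -/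
theorem measurePreserving_sub_right (Λ : PointerScale) {z : Coord d} (hz : z ∈ Λ.points d) :
    MeasurePreserving (fun y => y - z) (Λ.volumeMeasure d) (Λ.volumeMeasure d) := by
  have hpre : (fun y => y - z) ⁻¹' Λ.points d = Λ.points d :=
    Set.ext fun y => Λ.sub_mem_points_iff hz
  cases Λ with
  | continuum => exact MeasureTheory.measurePreserving_sub_right volume z
  | lattice ε hε =>
    have h := ((MeasureTheory.measurePreserving_sub_right (Measure.count : Measure (Coord d))
      z).restrict_preimage (measurableSet_points (lattice ε hε))).smul_measure
        (ENNReal.ofReal (ε ^ d))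
    rwa [hpre] at h

end PointerScale

/-! ### Mean square bounds for the reduction operators -/

section Reduction

open SpectralMeasure
open scoped ENNReal

variable {𝓗 : Type*} [NormedAddCommGroup 𝓗] [InnerProductSpace ℂ 𝓗] [CompleteSpace 𝓗] {d : ℕ}
  {E : SpectralMeasure (Coord d) 𝓗} {κ : ℝ} {Λ : PointerScale} {f₀ : Coord d → ℂ}

theorem lintegral_enorm_sq_eq_one (hf₀ : MemLp f₀ 2 (Λ.volumeMeasure d))
    (hnorm : ∫ y, ‖f₀ y‖ ^ 2 ∂(Λ.volumeMeasure d) = 1) :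
    ∫⁻ y, ‖f₀ y‖ₑ ^ 2 ∂(Λ.volumeMeasure d) = 1 := by
  have h := ofReal_integral_eq_lintegral_ofReal (hf₀.integrable_norm_pow two_ne_zero)
    (Eventually.of_forall fun y => by positivity)
  simp only [hnorm, ENNReal.ofReal_one] at h
  simpa [ENNReal.ofReal_pow] using h.symm

theorem lintegral_enorm_sq_eq_one_of_ae_eq (hf₀ : MemLp f₀ 2 (Λ.volumeMeasure d))
    (hnorm : ∫ y, ‖f₀ y‖ ^ 2 ∂(Λ.volumeMeasure d) = 1) {g : Coord d → ℂ}
    (h : f₀ =ᵐ[Λ.volumeMeasure d] g) : ∫⁻ y, ‖g y‖ₑ ^ 2 ∂(Λ.volumeMeasure d) = 1 := by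
  rw [← lintegral_enorm_sq_eq_one hf₀ hnorm]
  exact lintegral_congr_ae (h.mono fun y hy => by simp only [hy])

theorem isProbabilityMeasure_inputMeasure (hf₀ : MemLp f₀ 2 (Λ.volumeMeasure d))
    (hnorm : ∫ y, ‖f₀ y‖ ^ 2 ∂(Λ.volumeMeasure d) = 1) :
    IsProbabilityMeasure (inputMeasure Λ f₀) := by
  refine ⟨?_⟩
  rw [inputMeasure, withDensity_apply _ MeasurableSet.univ, Measure.restrict_univ]
  simpa [ENNReal.ofReal_pow] using lintegral_enorm_sq_eq_one hf₀ hnorm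

theorem inputMeasure_congr {g : Coord d → ℂ} (h : f₀ =ᵐ[Λ.volumeMeasure d] g) :
    inputMeasure Λ f₀ = inputMeasure Λ g :=
  withDensity_congr_ae (h.mono fun y hy => by simp only [hy])

theorem inputMeasure_absolutelyContinuous : inputMeasure Λ f₀ ≪ Λ.volumeMeasure d :=
  withDensity_absolutelyContinuous _ _

theorem ae_inputMeasure_ne_zero (hf₀ : AEStronglyMeasurable f₀ (Λ.volumeMeasure d)) :
    ∀ᵐ y ∂inputMeasure Λ f₀, f₀ y ≠ 0 := by
  rw [inputMeasure, ae_withDensity_iff' (by fun_prop)]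
  refine Eventually.of_forall fun y hy h0 => hy ?_
  simp [h0]

theorem measurableSet_smul_notMem_points (κ : ℝ) (Λ : PointerScale) :
    MeasurableSet {x : Coord d | ¬ κ • x ∈ Λ.points d} :=
  (measurable_const_smul κ Λ.measurableSet_points).compl

theorem measurable_shift : Measurable fun p : Coord d × Coord d => p.1 - κ • p.2 := by
  fun_prop

/-- A property which holds `λ`-almost everywhere holds at almost all points `y - κx`. -/
theorem ae_ae_shift (hΛ : E.proj {x | κ • x ∉ Λ.points d} = 0) (ψ : 𝓗) {p : Coord d → Prop}
    (hp : ∀ᵐ y ∂Λ.volumeMeasure d, p y) :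
    ∀ᵐ y ∂Λ.volumeMeasure d, ∀ᵐ x ∂E.measure ψ, p (y - κ • x) := by
  obtain ⟨N, hpN, hN, hN0⟩ := exists_measurable_superset_of_null (ae_iff.1 hp)
  have h1 : ∀ᵐ x ∂E.measure ψ, ∀ᵐ y ∂Λ.volumeMeasure d, y - κ • x ∉ N := by
    filter_upwards [E.ae_of_proj_eq_zero (measurableSet_smul_notMem_points κ Λ) hΛ ψ] with x hx
    refine (Λ.measurePreserving_sub_right hx).quasiMeasurePreserving.ae (p := fun y => y ∉ N) ?_
    rw [ae_iff]
    simpa using hN0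
  have hm : MeasurableSet {q : Coord d × Coord d | q.2 - κ • q.1 ∉ N} :=
    (measurable_shift.comp measurable_swap hN).compl
  filter_upwards [(Measure.ae_ae_comm hm).1 h1] with y hy
  filter_upwards [hy] with x hx
  by_contra h
  exact hx (hpN h)

theorem lintegral_lintegral_shift (hΛ : E.proj {x | κ • x ∉ Λ.points d} = 0) (ψ : 𝓗)
    {h : Coord d → ℝ≥0∞} (hh : Measurable h) :
    ∫⁻ y, ∫⁻ x, h (y - κ • x) ∂E.measure ψ ∂Λ.volumeMeasure d =
      (∫⁻ y, h y ∂Λ.volumeMeasure d) * ‖ψ‖ₑ ^ 2 := by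
  rw [lintegral_lintegral_swap (f := fun y x => h (y - κ • x))
    (hh.comp measurable_shift).aemeasurable, ← E.measure_univ ψ,
    ← lintegral_const]
  refine lintegral_congr_ae ?_
  filter_upwards [E.ae_of_proj_eq_zero (measurableSet_smul_notMem_points κ Λ) hΛ ψ] with x hx
  exact (Λ.measurePreserving_sub_right hx).lintegral_comp hh

theorem measurable_uncurry_reductionSymbol {g : Coord d → ℂ} (hg : Measurable g) (κ : ℝ) :
    Measurable fun p : Coord d × Coord d => reductionSymbol g κ p.1 p.2 :=
  (hg.comp measurable_shift).div (hg.comp measurable_fst)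

/-- The weight `|g(y)|²` cancels the denominator, leaving the integral of `|g(y - κx)|²`. Only an
inequality holds, since points with `g(y) = 0` contribute nothing on the left. -/
theorem lintegral_eLpNorm_reductionSymbol_le (hΛ : E.proj {x | κ • x ∉ Λ.points d} = 0) (ψ : 𝓗)
    {g : Coord d → ℂ} (hg : Measurable g) (hg1 : ∫⁻ y, ‖g y‖ₑ ^ 2 ∂(Λ.volumeMeasure d) = 1) :
    ∫⁻ y, eLpNorm (reductionSymbol g κ y) 2 (E.measure ψ) ^ 2 ∂inputMeasure Λ g ≤ ‖ψ‖ₑ ^ 2 := by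
  have hm := ((measurable_uncurry_reductionSymbol hg κ).enorm.pow_const 2).lintegral_prod_right'
    (ν := E.measure ψ)
  simp only [eLpNorm_two_sq]
  rw [inputMeasure, lintegral_withDensity_eq_lintegral_mul _ (by fun_prop) hm]
  refine (lintegral_mono fun y => ?_).trans
    (lintegral_lintegral_shift hΛ ψ (hg.enorm.pow_const 2)).le |>.trans (by rw [hg1, one_mul])
  rw [Pi.mul_apply, ENNReal.ofReal_pow (norm_nonneg _), ofReal_norm, ← lintegral_const_mul]
  · refine lintegral_mono fun x => ?_
    rw [← mul_pow, ← enorm_mul, reductionSymbol]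
    rcases eq_or_ne (g y) 0 with h | h
    · simp [h]
    · rw [mul_div_cancel₀ _ h]
  · exact ((measurable_uncurry_reductionSymbol hg κ).comp measurable_prodMk_left).enorm.pow_const 2

theorem ae_mem_dom_of_measurable (hΛ : E.proj {x | κ • x ∉ Λ.points d} = 0) (ψ : 𝓗)
    {g : Coord d → ℂ} (hg : Measurable g) (hg1 : ∫⁻ y, ‖g y‖ₑ ^ 2 ∂(Λ.volumeMeasure d) = 1) :
    ∀ᵐ y ∂inputMeasure Λ g, ψ ∈ E.dom (reductionSymbol g κ y) := by
  have hm := ((measurable_uncurry_reductionSymbol hg κ).enorm.pow_const 2).lintegral_prod_right'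
    (ν := E.measure ψ)
  have h := (lintegral_eLpNorm_reductionSymbol_le hΛ ψ hg hg1).trans_lt
    (ENNReal.pow_lt_top enorm_lt_top)
  simp only [eLpNorm_two_sq] at h
  filter_upwards [ae_lt_top hm h.ne] with y hy
  refine ⟨((measurable_uncurry_reductionSymbol hg κ).comp
    measurable_prodMk_left).aestronglyMeasurable, ?_⟩
  rw [← eLpNorm_two_sq] at hy
  exact (ENNReal.pow_lt_top_iff.1 hy).resolve_right two_ne_zero

/-- `f₀` is only almost everywhere measurable; this allows its replacement by a measurable
representative inside the calculus. -/
theorem ae_reductionSymbol_eq (hΛ : E.proj {x | κ • x ∉ Λ.points d} = 0) (ψ : 𝓗)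
    {g : Coord d → ℂ} (h : f₀ =ᵐ[Λ.volumeMeasure d] g) :
    ∀ᵐ y ∂inputMeasure Λ f₀, reductionSymbol f₀ κ y =ᵐ[E.measure ψ] reductionSymbol g κ y := by
  refine inputMeasure_absolutelyContinuous.ae_le ?_
  filter_upwards [ae_ae_shift hΛ ψ h, h] with y hy h0
  filter_upwards [hy] with x hx
  rw [reductionSymbol, reductionSymbol, hx, h0]

theorem ae_mem_dom_reductionSymbol (hΛ : E.proj {x | κ • x ∉ Λ.points d} = 0)
    (hf₀ : MemLp f₀ 2 (Λ.volumeMeasure d))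
    (hnorm : ∫ y, ‖f₀ y‖ ^ 2 ∂(Λ.volumeMeasure d) = 1) (ψ : 𝓗) :
    ∀ᵐ y ∂inputMeasure Λ f₀, ψ ∈ E.dom (reductionSymbol f₀ κ y) := by
  have hg := hf₀.1.ae_eq_mk
  have hg1 := lintegral_enorm_sq_eq_one_of_ae_eq hf₀ hnorm hg
  have h := ae_mem_dom_of_measurable hΛ ψ hf₀.1.stronglyMeasurable_mk.measurable hg1
  rw [← inputMeasure_congr hg] at h
  filter_upwards [h, ae_reductionSymbol_eq hΛ ψ hg] with y hy he
  exact (E.mem_dom_congr_ae he).2 hy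

theorem eLpNorm_reductionOp_le (hΛ : E.proj {x | κ • x ∉ Λ.points d} = 0)
    (hf₀ : MemLp f₀ 2 (Λ.volumeMeasure d))
    (hnorm : ∫ y, ‖f₀ y‖ ^ 2 ∂(Λ.volumeMeasure d) = 1) (ψ : 𝓗) :
    eLpNorm (fun y => reductionOp E f₀ κ y ψ) 2 (inputMeasure Λ f₀) ≤ ‖ψ‖ₑ := by
  have hg := hf₀.1.ae_eq_mk
  have hg1 := lintegral_enorm_sq_eq_one_of_ae_eq hf₀ hnorm hg
  have h := lintegral_eLpNorm_reductionSymbol_le hΛ ψ hf₀.1.stronglyMeasurable_mk.measurable hg1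
  rw [← inputMeasure_congr hg] at h
  rw [← (ENNReal.pow_right_strictMono two_ne_zero).le_iff_le, eLpNorm_two_sq]
  refine (lintegral_mono_ae ?_).trans h
  filter_upwards [ae_mem_dom_reductionSymbol hΛ hf₀ hnorm ψ, ae_reductionSymbol_eq hΛ ψ hg]
    with y hy he
  rw [← eLpNorm_congr_ae he]
  gcongr
  exact E.enorm_integral_le hy

theorem memLp_reductionOp (hΛ : E.proj {x | κ • x ∉ Λ.points d} = 0)
    (hf₀ : MemLp f₀ 2 (Λ.volumeMeasure d))
    (hnorm : ∫ y, ‖f₀ y‖ ^ 2 ∂(Λ.volumeMeasure d) = 1) (ψ : 𝓗) :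
    MemLp (fun y => reductionOp E f₀ κ y ψ) 2 (inputMeasure Λ f₀) := by
  refine ⟨?_, (eLpNorm_reductionOp_le hΛ hf₀ hnorm ψ).trans_lt enorm_lt_top⟩
  have hg := hf₀.1.ae_eq_mk
  have hsymb := ae_reductionSymbol_eq hΛ ψ hg
  have hdom : ∀ᵐ y ∂inputMeasure Λ f₀, ψ ∈ E.dom (reductionSymbol (hf₀.1.mk f₀) κ y) := by
    filter_upwards [ae_mem_dom_reductionSymbol hΛ hf₀ hnorm ψ, hsymb] with y hy he
    exact (E.mem_dom_congr_ae he).1 hy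
  refine (E.aestronglyMeasurable_integral (measurable_uncurry_reductionSymbol
    hf₀.1.stronglyMeasurable_mk.measurable κ) hdom).congr ?_
  filter_upwards [hsymb] with y he
  exact (E.integral_congr_ae he).symm

end Reduction

section ForwardIncrements

variable {𝓗 : Type*} [NormedAddCommGroup 𝓗] [InnerProductSpace ℂ 𝓗] {t₀ t : ℝ}

/-- The left endpoint is left free, because at the kick `χ` still has the value of the earlier
orbit. -/
theorem integral_eq_of_forall_Ioc {F G : ℝ → 𝓗} {a b : ℝ} (hab : a ≤ b) (hG : Continuous G)
    (h : ∀ s ∈ Ioc a b, F s = G s) :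
    IntervalIntegrable F volume a b ∧ ∫ s in a..b, F s = ∫ s in a..b, G s := by
  rw [← uIoc_of_le hab] at h
  exact ⟨(hG.intervalIntegrable a b).congr fun s hs => (h s hs).symm,
    intervalIntegral.integral_congr_ae (Eventually.of_forall h)⟩

/-! ### The kick measure and sums of forward increments -/

theorem unitStep_of_pos (ht : 0 < t) : unitStep t = 1 := if_pos ht

theorem unitStep_of_nonpos (ht : t ≤ 0) : unitStep t = 0 := if_neg ht.not_gt

theorem sum_unitStep_smul_of_nonpos {p : ℕ → ℝ} (hp : Monotone p) {n : ℕ} (hn : p n ≤ 0)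
    (B : ℕ → 𝓗) :
    ∑ i ∈ Finset.range n, ((unitStep (p (i + 1)) - unitStep (p i) : ℝ) : ℂ) • B i = 0 := by
  refine Finset.sum_eq_zero fun i hi => ?_
  have hi : i + 1 ≤ n := Finset.mem_range.1 hi
  rw [unitStep_of_nonpos ((hp hi).trans hn),
    unitStep_of_nonpos ((hp (Nat.le_of_succ_le hi)).trans hn)]
  simp

/-- `p (k + 1)` is the first partition point after the kick. As `1_0 = 0`, the case `p k = 0`
belongs to the same interval, and the integrand is taken at its left end. -/
theorem exists_sum_unitStep_smul_eq {p : ℕ → ℝ} (hp : Monotone p) {n : ℕ} (h0 : p 0 ≤ 0)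
    (hn : 0 < p n) : ∃ k < n, p k ≤ 0 ∧ 0 < p (k + 1) ∧ ∀ B : ℕ → 𝓗,
      ∑ i ∈ Finset.range n, ((unitStep (p (i + 1)) - unitStep (p i) : ℝ) : ℂ) • B i = B k := by
  classical
  have hex : ∃ m, 0 < p m := ⟨n, hn⟩
  obtain ⟨k, hk⟩ : ∃ k, Nat.find hex = k + 1 := Nat.exists_eq_succ_of_ne_zero fun h => by
    have := Nat.find_spec hex
    rw [h] at this
    exact h0.not_gt this
  have h1 : 0 < p (k + 1) := hk ▸ Nat.find_spec hex
  have h2 : p k ≤ 0 := not_lt.1 (Nat.find_min hex (by omega))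
  have hkn : k < n := by
    have := Nat.find_min' hex hn
    omega
  refine ⟨k, hkn, h2, h1, fun B => ?_⟩
  rw [Finset.sum_eq_single_of_mem k (Finset.mem_range.2 hkn)]
  · simp [unitStep_of_pos h1, unitStep_of_nonpos h2]
  · intro i _ hik
    rcases lt_or_gt_of_ne hik with h | h
    · rw [unitStep_of_nonpos ((hp h).trans h2), unitStep_of_nonpos ((hp h.le).trans h2)]
      simp
    · have h3 : 0 < p i := h1.trans_le (hp h)
      rw [unitStep_of_pos (h3.trans_le (hp i.le_succ)), unitStep_of_pos h3]
      simp

theorem integral_kickMeasure_of_pos [CompleteSpace 𝓗] (ht₀ : t₀ ≤ 0) (ht : 0 < t) (B : ℝ → 𝓗) :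
    ∫ r in Ico t₀ t, B r ∂kickMeasure = B 0 := by
  classical
  rw [kickMeasure, restrict_dirac, if_pos (mem_Ico.2 ⟨ht₀, ht⟩), integral_dirac]

theorem integral_kickMeasure_of_nonpos (ht : t ≤ 0) (B : ℝ → 𝓗) :
    ∫ r in Ico t₀ t, B r ∂kickMeasure = 0 := by
  classical
  rw [kickMeasure, restrict_dirac, if_neg fun h => ht.not_gt (mem_Ico.1 h).2,
    integral_zero_measure]

end ForwardIncrements

section SingleKick

variable {𝓗 : Type*} [NormedAddCommGroup 𝓗] [InnerProductSpace ℂ 𝓗] [CompleteSpace 𝓗] {d : ℕ}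
  {H : 𝓗 →ₗ.[ℂ] 𝓗} {hbar : ℝ} {E : SpectralMeasure (Coord d) 𝓗} {f₀ : Coord d → ℂ} {κ : ℝ}
  {Λ : PointerScale} {t₀ t : ℝ} {η : 𝓗} {y : Coord d}

/-! ### The reduced state before and after the kick -/

theorem reductionSymbol_zero (hy : f₀ y ≠ 0) : reductionSymbol f₀ κ y 0 = 1 := by
  simp [reductionSymbol, hy]

theorem reductionOpAt_of_nonpos (hy : f₀ y ≠ 0) (ht : t ≤ 0) (ψ : 𝓗) :
    reductionOpAt E f₀ κ t y ψ = ψ := by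
  simp only [reductionOpAt, unitStep_of_nonpos ht, zero_smul, reductionSymbol_zero hy]
  rw [E.integral_const, one_smul]

theorem reductionOpAt_of_pos (ht : 0 < t) (ψ : 𝓗) :
    reductionOpAt E f₀ κ t y ψ = reductionOp E f₀ κ y ψ := by
  simp only [reductionOpAt, reductionOp, unitStep_of_pos ht, one_smul]

theorem mem_dom_reductionSymbol_unitStep (hy : f₀ y ≠ 0) {ψ : 𝓗}
    (hψ : ψ ∈ E.dom (reductionSymbol f₀ κ y)) (t : ℝ) :
    ψ ∈ E.dom fun x => reductionSymbol f₀ κ y (unitStep t • x) := by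
  rcases le_or_gt t 0 with ht | ht
  · simp only [unitStep_of_nonpos ht, zero_smul, reductionSymbol_zero hy]
    exact E.mem_dom_const 1 ψ
  · simp only [unitStep_of_pos ht, one_smul]
    exact hψ

/-- `U(t - t₀)U(-t₀)† = U(t - t₀)U(t₀) = U(t)`. -/
theorem reducedState_eq (hU : IsUnitaryGroupOf H hbar (propagator H hbar)) :
    reducedState H hbar E f₀ κ t₀ η t y =
      propagator H hbar t (reductionOpAt E f₀ κ t y (propagator H hbar (-t₀) η)) := by
  rw [reducedState, reductionOpHeis, hU.adjoint_eq, hU.apply_apply, neg_neg, sub_add_cancel]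

theorem reducedState_of_nonpos (hU : IsUnitaryGroupOf H hbar (propagator H hbar)) (hy : f₀ y ≠ 0)
    (ht : t ≤ 0) : reducedState H hbar E f₀ κ t₀ η t y =
      propagator H hbar t (propagator H hbar (-t₀) η) := by
  rw [reducedState_eq hU, reductionOpAt_of_nonpos hy ht]

theorem reducedState_of_pos (hU : IsUnitaryGroupOf H hbar (propagator H hbar)) (ht : 0 < t) :
    reducedState H hbar E f₀ κ t₀ η t y =
      propagator H hbar t (reductionOp E f₀ κ y (propagator H hbar (-t₀) η)) := by
  rw [reducedState_eq hU, reductionOpAt_of_pos ht]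

theorem kickIntegrand_zero (hU : IsUnitaryGroupOf H hbar (propagator H hbar)) (hy : f₀ y ≠ 0) :
    kickIntegrand E f₀ κ (reducedState H hbar E f₀ κ t₀ η) 0 y =
      reductionOp E f₀ κ y (propagator H hbar (-t₀) η) - propagator H hbar (-t₀) η := by
  rw [kickIntegrand, reducedState_of_nonpos hU hy le_rfl, hU.zero_apply]

/-! ### The kick equation at a fixed pointer value -/

theorem mild_equation (hU : IsUnitaryGroupOf H hbar (propagator H hbar)) (ht₀ : t₀ ≤ 0)
    (hy : f₀ y ≠ 0) (t : ℝ) :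
    reducedState H hbar E f₀ κ t₀ η t y = propagator H hbar t (propagator H hbar (-t₀) η +
      ∫ r in Ico t₀ t, propagator H hbar (-r)
        (kickIntegrand E f₀ κ (reducedState H hbar E f₀ κ t₀ η) r y) ∂kickMeasure) := by
  rcases le_or_gt t 0 with ht | ht
  · rw [integral_kickMeasure_of_nonpos ht, add_zero, reducedState_of_nonpos hU hy ht]
  · rw [integral_kickMeasure_of_pos ht₀ ht, reducedState_of_pos hU ht, kickIntegrand_zero hU hy,
      neg_zero, hU.zero_apply, add_sub_cancel]

theorem IsUnitaryGroupOf.exists_mem_graph_integral {U : ℝ → 𝓗 →L[ℂ] 𝓗}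
    (hU : IsUnitaryGroupOf H hbar U) {F : ℝ → 𝓗} {φ : 𝓗} {a b : ℝ} (hab : a ≤ b)
    (h : ∀ s ∈ Ioc a b, F s = U s φ) :
    IntervalIntegrable F volume a b ∧ ∃ z, (∫ s in a..b, F s, z) ∈ H.graph ∧
      (Complex.I / (hbar : ℂ)) • z = U a φ - U b φ := by
  obtain ⟨h1, h2⟩ := integral_eq_of_forall_Ioc hab (hU.continuous φ) h
  obtain ⟨hw, hz⟩ := hU.exists_mem_domain_integral φ a b
  refine ⟨h1, _, ?_, hz⟩
  rw [h2]
  exact LinearPMap.mem_graph H ⟨_, hw⟩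

theorem integral_equation (hU : IsUnitaryGroupOf H hbar (propagator H hbar)) (ht₀ : t₀ ≤ 0)
    (hy : f₀ y ≠ 0) (ht₀t : t₀ ≤ t) :
    IntervalIntegrable (fun s => reducedState H hbar E f₀ κ t₀ η s y) volume t₀ t ∧
    ∃ hw : (∫ s in t₀..t, reducedState H hbar E f₀ κ t₀ η s y) ∈ H.domain,
      reducedState H hbar E f₀ κ t₀ η t y - η + (Complex.I / (hbar : ℂ)) •
        H ⟨∫ s in t₀..t, reducedState H hbar E f₀ κ t₀ η s y, hw⟩ =
      kickTerm E f₀ κ t₀ (reducedState H hbar E f₀ κ t₀ η) t y := by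
  set χ := reducedState H hbar E f₀ κ t₀ η
  have hη : propagator H hbar t₀ (propagator H hbar (-t₀) η) = η := by
    rw [hU.apply_apply, add_neg_cancel, hU.zero_apply]
  -- Stated through the graph, the contributions before and after the kick add without transporting
  -- domain proofs.
  suffices h : IntervalIntegrable (fun s => χ s y) volume t₀ t ∧
      ∃ z, (∫ s in t₀..t, χ s y, z) ∈ H.graph ∧
        χ t y - η + (Complex.I / (hbar : ℂ)) • z = kickTerm E f₀ κ t₀ χ t y by
    obtain ⟨h1, z, hz, h2⟩ := h
    obtain ⟨x, hx1, hx2⟩ := (LinearPMap.mem_graph_iff _).1 hz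
    simp only at hx1 hx2
    refine ⟨h1, hx1 ▸ x.2, ?_⟩
    have hx : (⟨∫ s in t₀..t, χ s y, hx1 ▸ x.2⟩ : H.domain) = x := Subtype.ext hx1.symm
    rw [hx, hx2, h2]
  rcases le_or_gt t 0 with ht | ht
  · obtain ⟨h1, z, hz, h2⟩ := hU.exists_mem_graph_integral (F := fun s => χ s y) ht₀t
      fun s hs => reducedState_of_nonpos hU hy (hs.2.trans ht)
    refine ⟨h1, z, hz, ?_⟩
    rw [h2, hη, kickTerm, integral_kickMeasure_of_nonpos ht,
      show χ t y = _ from reducedState_of_nonpos hU hy ht]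
    abel
  · obtain ⟨h1, z, hz, h2⟩ := hU.exists_mem_graph_integral (F := fun s => χ s y) ht₀
      fun s hs => reducedState_of_nonpos hU hy hs.2
    obtain ⟨h1', z', hz', h2'⟩ := hU.exists_mem_graph_integral (F := fun s => χ s y) ht.le
      fun s hs => reducedState_of_pos hU hs.1
    refine ⟨h1.trans h1', z + z', ?_, ?_⟩
    · rw [← intervalIntegral.integral_add_adjacent_intervals h1 h1']
      exact add_mem hz hz'
    · rw [smul_add, h2, h2', hη, hU.zero_apply, hU.zero_apply, kickTerm,
        integral_kickMeasure_of_pos ht₀ ht, kickIntegrand_zero hU hy,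
        show χ t y = _ from reducedState_of_pos hU ht]
      abel

/-- The domain is invariant under the group, so one point of the orbit in it brings in `φ`. Then `F`
is itself an orbit, hence continuous on `S`, and integrability of `Hχ` comes for free. -/
theorem IsUnitaryGroupOf.exists_eq_apply_of_mem_graph {U : ℝ → 𝓗 →L[ℂ] 𝓗}
    (hU : IsUnitaryGroupOf H hbar U) (hhbar : hbar ≠ 0) {φ : 𝓗} {F : ℝ → 𝓗} {S : Set ℝ}
    (hS : S.Nonempty) (h : ∀ s ∈ S, (U s φ, F s) ∈ H.graph) :
    ∃ ζ, (φ, ζ) ∈ H.graph ∧ ∀ s ∈ S, F s = U s ζ := by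
  obtain ⟨r, hr⟩ := hS
  have h1 := hU.mem_graph_apply hhbar (h r hr) (-r)
  simp only [hU.apply_apply, neg_add_cancel, hU.zero_apply] at h1
  exact ⟨_, h1, fun s hs => LinearPMap.mem_graph_snd_inj _ (h s hs)
    (hU.mem_graph_apply hhbar h1 s) rfl⟩

theorem strong_equation (hU : IsUnitaryGroupOf H hbar (propagator H hbar)) (hhbar : hbar ≠ 0)
    (ht₀ : t₀ ≤ 0) (hy : f₀ y ≠ 0) (ht₀t : t₀ ≤ t) {Hχ : ℝ → 𝓗}
    (hHχ : ∀ s ∈ Icc t₀ t, (reducedState H hbar E f₀ κ t₀ η s y, Hχ s) ∈ H.graph) :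
    IntervalIntegrable Hχ volume t₀ t ∧
      reducedState H hbar E f₀ κ t₀ η t y - η + (Complex.I / (hbar : ℂ)) • (∫ s in t₀..t, Hχ s) =
        kickTerm E f₀ κ t₀ (reducedState H hbar E f₀ κ t₀ η) t y := by
  have hη : propagator H hbar t₀ (propagator H hbar (-t₀) η) = η := by
    rw [hU.apply_apply, add_neg_cancel, hU.zero_apply]
  rcases le_or_gt t 0 with ht | ht
  · obtain ⟨ζ, hζ, hF⟩ := hU.exists_eq_apply_of_mem_graph hhbar (nonempty_Icc.2 ht₀t)
      fun s hs => by
        rw [← reducedState_of_nonpos (E := E) (κ := κ) hU hy (hs.2.trans ht)]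
        exact hHχ s hs
    obtain ⟨h1, h2⟩ := integral_eq_of_forall_Ioc ht₀t (hU.continuous ζ)
      fun s hs => hF s (Ioc_subset_Icc_self hs)
    refine ⟨h1, ?_⟩
    rw [h2, hU.smul_integral_eq hζ, hη, kickTerm, integral_kickMeasure_of_nonpos ht,
      reducedState_of_nonpos hU hy ht]
    abel
  · obtain ⟨ζ, hζ, hF⟩ := hU.exists_eq_apply_of_mem_graph hhbar (nonempty_Icc.2 ht₀)
      fun s hs => by
        rw [← reducedState_of_nonpos (E := E) (κ := κ) hU hy hs.2]
        exact hHχ s ⟨hs.1, hs.2.trans ht.le⟩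
    obtain ⟨ζ', hζ', hF'⟩ := hU.exists_eq_apply_of_mem_graph hhbar (nonempty_Ioc.2 ht)
      fun s hs => by
        rw [← reducedState_of_pos (E := E) (κ := κ) (f₀ := f₀) (y := y) hU hs.1]
        exact hHχ s ⟨ht₀.trans hs.1.le, hs.2⟩
    obtain ⟨h1, h2⟩ := integral_eq_of_forall_Ioc ht₀ (hU.continuous ζ)
      fun s hs => hF s (Ioc_subset_Icc_self hs)
    obtain ⟨h1', h2'⟩ := integral_eq_of_forall_Ioc ht.le (hU.continuous ζ') hF'
    refine ⟨h1.trans h1', ?_⟩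
    rw [← intervalIntegral.integral_add_adjacent_intervals h1 h1', h2, h2', smul_add,
      hU.smul_integral_eq hζ, hU.smul_integral_eq hζ', hη, hU.zero_apply, hU.zero_apply, kickTerm,
      integral_kickMeasure_of_pos ht₀ ht, kickIntegrand_zero hU hy, reducedState_of_pos hU ht]
    abel

/-! ### Mean square properties -/

theorem memLp_reducedState (hU : IsUnitaryGroupOf H hbar (propagator H hbar))
    (hΛ : E.proj {x | κ • x ∉ Λ.points d} = 0) (hf₀ : MemLp f₀ 2 (Λ.volumeMeasure d))
    (hnorm : ∫ y, ‖f₀ y‖ ^ 2 ∂(Λ.volumeMeasure d) = 1) (t : ℝ) :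
    MemLp (reducedState H hbar E f₀ κ t₀ η t) 2 (inputMeasure Λ f₀) := by
  have := isProbabilityMeasure_inputMeasure hf₀ hnorm
  rcases le_or_gt t 0 with ht | ht
  · refine (memLp_congr_ae ?_).1 (memLp_const (propagator H hbar t (propagator H hbar (-t₀) η)))
    filter_upwards [ae_inputMeasure_ne_zero hf₀.1] with y hy
    exact (reducedState_of_nonpos hU hy ht).symm
  · have h : reducedState H hbar E f₀ κ t₀ η t = fun y => propagator H hbar t
        (reductionOp E f₀ κ y (propagator H hbar (-t₀) η)) :=
      funext fun y => reducedState_of_pos hU ht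
    rw [h]
    exact (propagator H hbar t).comp_memLp'
      (memLp_reductionOp hΛ hf₀ hnorm (propagator H hbar (-t₀) η))

/-- By linearity only `(G - I)(φ - ψ)` matters; `G` and `I` each contribute `‖φ - ψ‖`, the latter
because `μ₀` is a probability measure. -/
theorem eLpNorm_reductionOp_sub_le (hΛ : E.proj {x | κ • x ∉ Λ.points d} = 0)
    (hf₀ : MemLp f₀ 2 (Λ.volumeMeasure d))
    (hnorm : ∫ y, ‖f₀ y‖ ^ 2 ∂(Λ.volumeMeasure d) = 1) (φ ψ : 𝓗) :
    eLpNorm (fun y => (reductionOp E f₀ κ y φ - φ) - (reductionOp E f₀ κ y ψ - ψ)) 2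
      (inputMeasure Λ f₀) ≤ 2 * ‖φ - ψ‖ₑ := by
  have := isProbabilityMeasure_inputMeasure hf₀ hnorm
  have h : (fun y => (reductionOp E f₀ κ y φ - φ) - (reductionOp E f₀ κ y ψ - ψ))
      =ᵐ[inputMeasure Λ f₀] (fun y => reductionOp E f₀ κ y (φ - ψ)) - fun _ => φ - ψ := by
    filter_upwards [ae_mem_dom_reductionSymbol hΛ hf₀ hnorm φ,
      ae_mem_dom_reductionSymbol hΛ hf₀ hnorm ψ] with y hφ hψ
    rw [Pi.sub_apply, reductionOp, (E.integral_sub_vector hφ hψ).2]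
    abel
  rw [eLpNorm_congr_ae h, two_mul]
  refine (eLpNorm_sub_le (memLp_reductionOp hΛ hf₀ hnorm _).1 aestronglyMeasurable_const
    (by norm_num)).trans (add_le_add (eLpNorm_reductionOp_le hΛ hf₀ hnorm _) ?_)
  rw [eLpNorm_const _ two_ne_zero (NeZero.ne _)]
  simp

theorem isItoIntegral_kickTerm (hU : IsUnitaryGroupOf H hbar (propagator H hbar))
    (hΛ : E.proj {x | κ • x ∉ Λ.points d} = 0) (hf₀ : MemLp f₀ 2 (Λ.volumeMeasure d))
    (hnorm : ∫ y, ‖f₀ y‖ ^ 2 ∂(Λ.volumeMeasure d) = 1) (ht₀ : t₀ ≤ 0) (t : ℝ) :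
    IsItoIntegral (inputMeasure Λ f₀) unitStep
      (kickIntegrand E f₀ κ (reducedState H hbar E f₀ κ t₀ η)) t₀ t
      (kickTerm E f₀ κ t₀ (reducedState H hbar E f₀ κ t₀ η) t) := by
  intro ε hε
  set ξ := propagator H hbar (-t₀) η
  obtain ⟨δ, hδ, hcont⟩ := Metric.continuousAt_iff.1
    ((hU.continuous ξ).continuousAt (x := 0)) (ε / 2) (half_pos hε)
  refine ⟨δ, hδ, fun n p hp hp0 hpn hmesh => ?_⟩
  rcases le_or_gt t 0 with ht | ht
  · have h : ∀ y, (∑ i ∈ Finset.range n, ((unitStep (p (i + 1)) - unitStep (p i) : ℝ) : ℂ) •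
        kickIntegrand E f₀ κ (reducedState H hbar E f₀ κ t₀ η) (p i) y) -
        kickTerm E f₀ κ t₀ (reducedState H hbar E f₀ κ t₀ η) t y = 0 := fun y => by
      rw [sum_unitStep_smul_of_nonpos hp (hpn.trans_le ht)
        fun i => kickIntegrand E f₀ κ (reducedState H hbar E f₀ κ t₀ η) (p i) y, kickTerm,
        integral_kickMeasure_of_nonpos ht, sub_zero]
    simp only [h, eLpNorm_zero', zero_le]
  · obtain ⟨k, hkn, hk0, hk1, hsum⟩ :=
      exists_sum_unitStep_smul_eq (𝓗 := 𝓗) hp (hp0.trans_le ht₀) (hpn ▸ ht)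
    have h : (fun y => (∑ i ∈ Finset.range n, ((unitStep (p (i + 1)) - unitStep (p i) : ℝ) : ℂ) •
        kickIntegrand E f₀ κ (reducedState H hbar E f₀ κ t₀ η) (p i) y) -
        kickTerm E f₀ κ t₀ (reducedState H hbar E f₀ κ t₀ η) t y) =ᵐ[inputMeasure Λ f₀]
        fun y => (reductionOp E f₀ κ y (propagator H hbar (p k) ξ) - propagator H hbar (p k) ξ) -
          (reductionOp E f₀ κ y ξ - ξ) := by
      filter_upwards [ae_inputMeasure_ne_zero hf₀.1] with y hy
      rw [hsum fun i => kickIntegrand E f₀ κ (reducedState H hbar E f₀ κ t₀ η) (p i) y, kickTerm,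
        integral_kickMeasure_of_pos ht₀ ht, kickIntegrand_zero hU hy, kickIntegrand,
        reducedState_of_nonpos hU hy hk0]
    rw [eLpNorm_congr_ae h]
    refine (eLpNorm_reductionOp_sub_le hΛ hf₀ hnorm _ _).trans ?_
    -- `p k ≤ 0 < p (k + 1)` and the mesh is below `δ`. The choice of `ε / 2` above absorbs the
    -- factor `2` of the estimate.
    have hpk : dist (p k) 0 < δ := by
      rw [Real.dist_eq, sub_zero, abs_of_nonpos hk0]
      linarith [hmesh k hkn]
    have h1 := hcont hpk
    rw [hU.zero_apply, dist_eq_norm] at h1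
    rw [← ofReal_norm, ← ENNReal.ofReal_ofNat 2, ← ENNReal.ofReal_mul (by norm_num)]
    exact ENNReal.ofReal_le_ofReal (by linarith)

end SingleKick

end

/-! ### The single-kick equation -/

theorem theorem1 {𝓗 : Type*} [NormedAddCommGroup 𝓗] [InnerProductSpace ℂ 𝓗] [CompleteSpace 𝓗]
    {d : ℕ}
    -- the Hamiltonian of the particle, and Planck's constant
    (H : 𝓗 →ₗ.[ℂ] 𝓗) (hH : IsSelfAdjoint H) (hbar : ℝ) (hhbar : 0 < hbar)
    -- the measured commuting self-adjoint operators, with their joint spectral measure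
    (R : Fin d → (𝓗 →ₗ.[ℂ] 𝓗)) (hR : ∀ α, IsSelfAdjoint (R α))
    (E : SpectralMeasure (Coord d) 𝓗) (hE : IsJointSpectralMeasure R E)
    (κ : ℝ) (hκ : 0 < κ)
    -- the pointer scale, which contains the values of `κR`
    (Λ : PointerScale) (hΛ : E.proj {x | κ • x ∉ Λ.points d} = 0)
    -- the initial state vector of the pointer
    (f₀ : Coord d → ℂ) (hf₀ : MemLp f₀ 2 (Λ.volumeMeasure d))
    (hnorm : ∫ y, ‖f₀ y‖ ^ 2 ∂(Λ.volumeMeasure d) = 1)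
    -- the initial instant and the initial state vector of the particle
    (t₀ : ℝ) (ht₀ : t₀ ≤ 0) (η : 𝓗) :
    IsProbabilityMeasure (inputMeasure Λ f₀) ∧
    -- all vectors to which `G_t(y)` is applied in `χ(t, y)` are in its domain
    (∀ᵐ y ∂(inputMeasure Λ f₀), ∀ t, propagator H hbar (-t₀) η ∈
      E.dom (fun x => reductionSymbol f₀ κ y (unitStep t • x))) ∧
    SolvesSingleKick H hbar E f₀ κ (inputMeasure Λ f₀) t₀ η
      (reducedState H hbar E f₀ κ t₀ η) := by
  have hU := hH.isUnitaryGroupOf_propagator hhbar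
  -- The pathwise clauses use only `f₀ y ≠ 0`, so one null set serves all times: the value of `G(y)`
  -- at `ξ` enters both sides identically. The domain clauses exclude further null sets, in
  -- `mem_dom` one for each `r`.
  have hne := ae_inputMeasure_ne_zero hf₀.1
  refine ⟨isProbabilityMeasure_inputMeasure hf₀ hnorm, ?_,
    { memLp := fun t _ => memLp_reducedState hU hΛ hf₀ hnorm t
      initial := ?_
      mem_dom := fun r _ hr0 => ?_
      ito := fun t _ => isItoIntegral_kickTerm hU hΛ hf₀ hnorm ht₀ t
      equation := hne.mono fun y hy t ht => integral_equation hU ht₀ hy ht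
      strong := hne.mono fun y hy t ht _ h => strong_equation hU hhbar.ne' ht₀ hy ht h
      mild := hne.mono fun y hy t _ => mild_equation hU ht₀ hy t }⟩
  · filter_upwards [hne, ae_mem_dom_reductionSymbol hΛ hf₀ hnorm (propagator H hbar (-t₀) η)]
      with y hy hdom
    exact mem_dom_reductionSymbol_unitStep hy hdom
  · filter_upwards [hne] with y hy
    rw [reducedState_of_nonpos hU hy ht₀, hU.apply_apply, add_neg_cancel, hU.zero_apply]
  · filter_upwards [hne, ae_mem_dom_reductionSymbol hΛ hf₀ hnorm
      (propagator H hbar r (propagator H hbar (-t₀) η))] with y hy hdom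
    rwa [reducedState_of_nonpos hU hy hr0]
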